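/- Let $[n]=\{1,\dots,n\}$. A set operad $\mathcal P=(\mathcal P_n)_{n\ge 1}$ is a monoid $(\mathcal P,\mu,\varepsilon)$ in the category of $\mathbb S$-sets with the composition product $\circ$. It is *binary quadratic* if it is the quotient of the free set operad on an $\mathbb S_2$-set (placed in arity $2$) by relations between labelled trees with two vertices. It is *weakly associative* if for all $i,j\in\mathcal P_2$ there are $k,l\in\mathcal P_2$ such that $(a\circ_i b)\circ_j c=a\circ_l(b\circ_k c)$, i.e. $\mu(j;i,1)=\mu(l;1,k)$ in $\mathcal P_3$. The poset $\Pi_{\mathcal P}(n)$ consists of the $\mathcal P$-partitions $\{(B_1,p_1),\dots,(B_s,p_s)\}$ of $[n]$, where $\{B_1,\dots,B_s\}$ is a partition of $[n]$ and $p_i\in\mathcal P_{|B_i|}$ (the inputs of $p_i$ correspond to the elements of $B_i$ in ascending order). One has $\{(A_i,p_i)\}_i\le\{(B_j,q_j)\}_j$ if $\{A_i\}$ refines $\{B_j\}$ and, whenever $B_j=A_{i_1}\sqcup\dots\sqcup A_{i_t}$, there is $p\in\mathcal P_t$ with $q_j=\mu(p;p_{i_1},\dots,p_{i_t})\sigma^{-1}$,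 where $\sigma\in\mathbb S_{|B_j|}$ is the permutation matching the elements of $B_j$ in ascending order with the concatenation of the ascending lists of the elements of $A_{i_1},\dots,A_{i_t}$. Its least element $\hat 0$ is the partition into singletons decorated by the identity. The *maximal intervals* of $\Pi_{\mathcal P}$ are the intervals $[\hat 0,\gamma]$ with $\gamma$ a maximal element of some $\Pi_{\mathcal P}(n)$. Let ${}^2\mathcal Com$ be the set operad with ${}^2\mathcal Com_n=\{D^n_0,\dots,D^n_{n-1}\}$, trivial actions and $\mu(D^k_i;D^{m_1}_{i_1},\dots,D^{m_k}_{i_k})=D^{m_1+\dots+m_k}_{i+i_1+\dots+i_k}$. Its partition poset $\Pi_{{}^2\mathcal Com}(n)$ is the poset of weighted partitions of $[n]$: each block $B$ carries a weight in $\{0,\dots,|B|-1\}$, and $\alpha\le\beta$ if $\alpha$ refines $\beta$ and, for every block $B$ of $\beta$ that is a union of $t$ blocks of $\alpha$, the weight of $B$ minus the sum of the weights of these $t$ blocks lies in $\{0,\dots,t-1\}$. Let ${}^2\mathcal P=\mathcal P\times_H{}^2\mathcal Com$ be the Hadamard product, $({}^2\mathcal P)_n=\mathcal P_n\times{}^2\mathcal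 Com_n$ with componentwise structure. A finite poset is *semimodular* if it has a least and a greatest element and any two distinct elements covering a common element are covered by a common element; a finite bounded poset is *totally semimodular* if all its intervals are semimodular. A poset is *CL-shellable* if it is finite, bounded and graded (all maximal chains have the same length) and has a CL-labeling: a labeling of the edges of its maximal chains by integers, in which two maximal chains that coincide along their first $d$ edges have the same labels there, and such that for every rooted interval $[x,y]_r$ ($x<y$, $r$ a maximal chain of $[\hat 0,x]$) there is exactly one maximal chain of $[x,y]$ whose labels are weakly increasing, and its word of labels is lexicographically smaller than that of every other maximal chain of $[x,y]$. **Proposition.** Let $\mathcal P$ be a weakly associative binary quadratic set operad such that all maximal intervals of $\Pi_{\mathcal P}$ are totally semimodular. Then, for every $n$, $\gamma\mapsto(\text{the underlying }\mathcal P\text{-partition},\text{ the underlying weighted partition})$ is an isomorphism of posets from $\Pi_{{}^2\mathcal P}(n)$ onto the fiber product $\Pi_{\mathcal P}(n)\times_{\Pi_n}\Pi_{{}^2\mathcal Com}(n)$ over the poset $\Pi_n$ of partitions of $[n]$, and all maximal intervals of $\Pi_{{}^2\mathcal P}$ are CL-shellable. -/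

import Mathlib

open Finset

universe u v

/-! ### Set operads -/

/-- A set operad: a monoid for the composition product of `𝕊`-sets (indexed by the arities `n ≥ 1`,
so there is nothing in arity `0`).

* `relabel σ p` is the action of the symmetric group, written as a left action: it is `p · σ⁻¹`
  for the usual right action.  The input number `r` of `p` becomes the input number `σ r`.
* An element of the composition product `P ∘ P` in arity `N` is represented by
  `(p, (q₁, …, q_k), e)`, where the bijection `e` tells which of the labels of `[N]` is attached to
  the `x`-th input of `q_i`; `comp m e p q` is its image under `μ : P ∘ P → P`. -/
structure SetOperad where
  Op : ℕ → Type u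
  isEmpty_zero : IsEmpty (Op 0)
  relabel : {n : ℕ} → Equiv.Perm (Fin n) → Op n → Op n
  one : Op 1
  comp : {k N : ℕ} → (m : Fin k → ℕ) → ((Σ i, Fin (m i)) ≃ Fin N) → Op k →
    ((i : Fin k) → Op (m i)) → Op N
  relabel_one : ∀ {n : ℕ} (p : Op n), relabel 1 p = p
  relabel_mul : ∀ {n : ℕ} (σ τ : Equiv.Perm (Fin n)) (p : Op n),
    relabel (σ * τ) p = relabel σ (relabel τ p)
  /-- `μ` is equivariant. -/
  comp_trans : ∀ {k N : ℕ} (m : Fin k → ℕ) (e : (Σ i, Fin (m i)) ≃ Fin N)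
    (σ : Equiv.Perm (Fin N)) (p : Op k) (q : (i : Fin k) → Op (m i)),
    comp m (e.trans σ) p q = relabel σ (comp m e p q)
  /-- `μ` is well defined on the orbits of `𝕊_{m₁} × ⋯ × 𝕊_{m_k}`. -/
  comp_relabel_right : ∀ {k N : ℕ} (m : Fin k → ℕ) (e : (Σ i, Fin (m i)) ≃ Fin N)
    (τ : (i : Fin k) → Equiv.Perm (Fin (m i))) (p : Op k) (q : (i : Fin k) → Op (m i)),
    comp m e p (fun i => relabel (τ i) (q i)) = comp m ((Equiv.sigmaCongrRight τ).trans e) p q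
  /-- `μ` is well defined on the orbits of `𝕊_k`. -/
  comp_relabel_left : ∀ {k N : ℕ} (m : Fin k → ℕ) (e : (Σ i, Fin (m i)) ≃ Fin N)
    (τ : Equiv.Perm (Fin k)) (p : Op k) (q : (i : Fin k) → Op (m i)),
    comp m e (relabel τ p) q =
      comp (fun i => m (τ i))
        ((Equiv.sigmaCongrLeft (β := fun i => Fin (m i)) τ).trans e) p (fun i => q (τ i))
  one_comp : ∀ {n : ℕ} (q : Op n),
    comp (fun _ : Fin 1 => n) (Equiv.uniqueSigma fun _ : Fin 1 => Fin n) one (fun _ => q) = q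
  comp_one : ∀ {k : ℕ} (p : Op k),
    comp (fun _ : Fin k => 1) (Equiv.sigmaUnique (Fin k) fun _ => Fin 1) p (fun _ => one) = p
  /-- Associativity: the labels of the two sides are matched by `hg`. -/
  assoc : ∀ {k K N : ℕ} (l : Fin k → ℕ) (f : (Σ i, Fin (l i)) ≃ Fin K)
    (m : Fin K → ℕ) (e : (Σ i, Fin (m i)) ≃ Fin N)
    (M : Fin k → ℕ) (h : (i : Fin k) → (Σ j : Fin (l i), Fin (m (f ⟨i, j⟩))) ≃ Fin (M i))
    (g : (Σ i, Fin (M i)) ≃ Fin N)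
    (_hg : ∀ (i : Fin k) (j : Fin (l i)) (x : Fin (m (f ⟨i, j⟩))),
      g ⟨i, h i ⟨j, x⟩⟩ = e ⟨f ⟨i, j⟩, x⟩)
    (p : Op k) (q : (i : Fin k) → Op (l i)) (r : (i : Fin K) → Op (m i)),
    comp m e (comp l f p q) r =
      comp M g p (fun i => comp (fun j => m (f ⟨i, j⟩)) (h i) (q i) (fun j => r (f ⟨i, j⟩)))

namespace SetOperad

/-- Morphisms of set operads. -/
structure Hom (P Q : SetOperad.{u}) where
  map : {n : ℕ} → P.Op n → Q.Op n
  map_relabel : ∀ {n : ℕ} (σ : Equiv.Perm (Fin n)) (p : P.Op n),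
    map (P.relabel σ p) = Q.relabel σ (map p)
  map_one : map P.one = Q.one
  map_comp : ∀ {k N : ℕ} (m : Fin k → ℕ) (e : (Σ i, Fin (m i)) ≃ Fin N) (p : P.Op k)
    (q : (i : Fin k) → P.Op (m i)),
    map (P.comp m e p q) = Q.comp m e (map p) (fun i => map (q i))

/-- The inputs of a pair of operations of arities `a` and `b`. -/
def pairEquiv (a b : ℕ) : (Σ i : Fin 2, Fin (![a, b] i)) ≃ Fin a ⊕ Fin b where
  toFun x := match x with
    | ⟨0, y⟩ => Sum.inl y
    | ⟨1, y⟩ => Sum.inr y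
  invFun x := match x with
    | Sum.inl y => ⟨0, y⟩
    | Sum.inr y => ⟨1, y⟩
  left_inv x := by
    obtain ⟨i, y⟩ := x
    fin_cases i <;> rfl
  right_inv x := by
    cases x <;> rfl

/-- The composite `c(p, q)` with a binary operation `c` at the root, whose inputs are labelled
by `σ`. -/
def comp₂ (P : SetOperad.{u}) {a b n : ℕ} (c : P.Op 2) (p : P.Op a) (q : P.Op b)
    (σ : Fin a ⊕ Fin b ≃ Fin n) : P.Op n :=
  P.comp ![a, b] ((pairEquiv a b).trans σ) c
    (fun i => match i with
      | 0 => p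
      | 1 => q)

/-- The operations that are values of labelled binary trees whose vertices are decorated by binary
operations. -/
inductive IsTreeValue (P : SetOperad.{u}) : {n : ℕ} → P.Op n → Prop
  | leaf : IsTreeValue P P.one
  | node {a b n : ℕ} (c : P.Op 2) (p : P.Op a) (q : P.Op b) (σ : Fin a ⊕ Fin b ≃ Fin n)
      (hp : IsTreeValue P p) (hq : IsTreeValue P q) : IsTreeValue P (P.comp₂ c p q σ)

/-- Binary quadratic set operads: `P` is the free set operad on the `𝕊₂`-set `P₂` modulo relations
between trees with two vertices.  That is, `P` is generated by its binary operations, and all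
relations follow from those between labelled trees with two vertices: an equivariant map from `P₂`
to `Q₂` that respects the latter relations extends to a morphism of operads. -/
class IsBinaryQuadratic (P : SetOperad.{u}) : Prop where
  generated : ∀ {n : ℕ} (p : P.Op n), P.IsTreeValue p
  presented : ∀ (Q : SetOperad.{u}) (φ : P.Op 2 → Q.Op 2),
    (∀ (σ : Equiv.Perm (Fin 2)) (c : P.Op 2), φ (P.relabel σ c) = Q.relabel σ (φ c)) →
    (∀ (c d c' d' : P.Op 2) (ρ ρ' : Fin 2 ⊕ Fin 1 ≃ Fin 3),
      P.comp₂ d c P.one ρ = P.comp₂ d' c' P.one ρ' →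
      Q.comp₂ (φ d) (φ c) Q.one ρ = Q.comp₂ (φ d') (φ c') Q.one ρ') →
    ∃ f : Hom P Q, ∀ c : P.Op 2, f.map c = φ c

/-- Weak associativity: every composite `(a ∘ᵢ b) ∘ⱼ c` of binary operations equals some
`a ∘ₗ (b ∘ₖ c)`. (By equivariance it is enough to label `a, b, c` by `1, 2, 3`.) -/
def IsWeaklyAssociative (P : SetOperad.{u}) : Prop :=
  ∀ i j : P.Op 2, ∃ k l : P.Op 2,
    (P.comp₂ j i P.one (finSumFinEquiv : Fin 2 ⊕ Fin 1 ≃ Fin 3)) =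
      P.comp₂ l P.one k (finSumFinEquiv : Fin 1 ⊕ Fin 2 ≃ Fin 3)

/-- The identity is the only operation of arity one. -/
class IsReduced (P : SetOperad.{u}) : Prop where
  eq_one : ∀ p : P.Op 1, p = P.one

theorem IsTreeValue.eq_one (P : SetOperad.{u}) {n : ℕ} {p : P.Op n} (hp : P.IsTreeValue p)
    (hn : n = 1) : p = hn ▸ P.one := by
  cases hp with
  | leaf => rfl
  | node c p q σ hp hq =>
    rename_i a b
    have h := Fintype.card_congr σ
    simp only [Fintype.card_sum, Fintype.card_fin] at h
    have := P.isEmpty_zero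
    rcases Nat.eq_zero_or_pos a with rfl | ha
    · exact isEmptyElim p
    rcases Nat.eq_zero_or_pos b with rfl | hb
    · exact isEmptyElim q
    omega

instance (P : SetOperad.{u}) [P.IsBinaryQuadratic] : P.IsReduced where
  eq_one p := (IsBinaryQuadratic.generated p).eq_one P rfl

/-- The Hadamard product of set operads. -/
def hadamard (P : SetOperad.{u}) (Q : SetOperad.{v}) : SetOperad.{max u v} where
  Op n := P.Op n × Q.Op n
  isEmpty_zero := ⟨fun x => P.isEmpty_zero.false x.1⟩
  relabel σ p := (P.relabel σ p.1, Q.relabel σ p.2)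
  one := (P.one, Q.one)
  comp m e p q := (P.comp m e p.1 (fun i => (q i).1), Q.comp m e p.2 (fun i => (q i).2))
  relabel_one p := by simp only [relabel_one]
  relabel_mul σ τ p := by simp only [relabel_mul]
  comp_trans m e σ p q := by simp only [comp_trans]
  comp_relabel_right m e τ p q := by simp only [comp_relabel_right]
  comp_relabel_left m e τ p q := by simp only [comp_relabel_left]
  one_comp q := by simp only [one_comp]
  comp_one p := by simp only [comp_one]
  assoc l f m e M h g hg p q r := by
    ext
    · exact P.assoc l f m e M h g hg _ _ _
    · exact Q.assoc l f m e M h g hg _ _ _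

instance (P : SetOperad.{u}) (Q : SetOperad.{v}) [P.IsReduced] [Q.IsReduced] :
    (P.hadamard Q).IsReduced where
  eq_one p := Prod.ext (IsReduced.eq_one p.1) (IsReduced.eq_one p.2)

theorem weight_lt {k N : ℕ} (m : Fin k → ℕ) (e : (Σ i, Fin (m i)) ≃ Fin N) (p : Fin k)
    (q : (i : Fin k) → Fin (m i)) : (p : ℕ) + ∑ i, (q i : ℕ) < N := by
  have h := Fintype.card_congr e
  simp only [Fintype.card_sigma, Fintype.card_fin] at h
  have h2 : ∑ i, ((q i : ℕ) + 1) ≤ ∑ i, m i := Finset.sum_le_sum fun i _ => (q i).2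
  simp only [Finset.sum_add_distrib, Finset.sum_const, Finset.card_univ, Fintype.card_fin,
    smul_eq_mul, mul_one] at h2
  have := p.2
  omega

/-- The set operad of two totally compatible commutative associative products. In arity `n` it
consists of the operations `D_i`, `0 ≤ i ≤ n - 1`, where `i` is the number of white products,
with trivial action, and `μ(D_i; D_{i₁}, …, D_{i_k}) = D_{i + i₁ + ⋯ + i_k}`. -/
def tcCom : SetOperad.{0} where
  Op n := Fin n
  isEmpty_zero := Fin.isEmpty
  relabel _ p := p
  one := 0
  comp m e p q := ⟨(p : ℕ) + ∑ i, (q i : ℕ), weight_lt m e p q⟩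
  relabel_one _ := rfl
  relabel_mul _ _ _ := rfl
  comp_trans _ _ _ _ _ := rfl
  comp_relabel_right _ _ _ _ _ := rfl
  comp_relabel_left m e τ p q := by
    ext
    simp only [Nat.add_left_cancel_iff]
    exact (Equiv.sum_comp τ fun i => (q i : ℕ)).symm
  one_comp q := by
    ext
    simp
  comp_one p := by
    ext
    simp
  assoc l f m e M h g hg p q r := by
    ext
    simp only [Finset.sum_add_distrib, add_assoc]
    congr 2
    rw [← Equiv.sum_comp f, Fintype.sum_sigma]

instance : tcCom.IsReduced where
  eq_one p := Subsingleton.elim (α := Fin 1) p _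

/-- The set operad of two totally compatible `P`-structures. -/
def tc (P : SetOperad.{u}) : SetOperad.{u} := P.hadamard tcCom

instance (P : SetOperad.{u}) [P.IsReduced] : P.tc.IsReduced :=
  inferInstanceAs (P.hadamard tcCom).IsReduced

/-! ### Operadic partition posets -/

/-- A `P`-partition of an `n`-element set: a partition whose blocks `B` are decorated by operations
of arity `|B|`. The inputs of the decoration correspond to the elements of `B` in ascending
order. -/
@[ext]
structure Partition (P : SetOperad.{u}) (n : ℕ) where
  part : Finpartition (univ : Finset (Fin n))
  dec : (B : part.parts) → P.Op (B : Finset (Fin n)).card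

namespace Partition

variable {P : SetOperad.{u}} {n : ℕ}

/-- The block `B` with decoration `q` is composed of the blocks `a 1, …, a t` of `α`:
these blocks are pairwise distinct with union `B`, and `q = μ(p; p₁, …, p_t) σ⁻¹` for some `p`, where
`p_i` is the decoration of `a i` and `σ` is the permutation matching the labels. -/
def IsComposite (α : P.Partition n) (B : Finset (Fin n)) (q : P.Op B.card) : Prop :=
  ∃ (t : ℕ) (a : Fin t → α.part.parts), Function.Injective a ∧
    (∀ A : α.part.parts, A ∈ Set.range a ↔ (A : Finset (Fin n)) ⊆ B) ∧
    ∃ (p : P.Op t) (e : (Σ i, Fin (a i : Finset (Fin n)).card) ≃ Fin B.card),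
      (∀ i x, B.orderEmbOfFin rfl (e ⟨i, x⟩) = (a i : Finset (Fin n)).orderEmbOfFin rfl x) ∧
      q = P.comp (fun i => (a i : Finset (Fin n)).card) e p (fun i => α.dec (a i))

instance : LE (P.Partition n) where
  le α β := α.part ≤ β.part ∧ ∀ B : β.part.parts, α.IsComposite B (β.dec B)

theorem le_def (α β : P.Partition n) :
    α ≤ β ↔ α.part ≤ β.part ∧ ∀ B : β.part.parts, α.IsComposite B (β.dec B) := Iff.rfl

theorem eq_of_subset (π : Finpartition (univ : Finset (Fin n))) (A B : π.parts)
    (h : (A : Finset (Fin n)) ⊆ B) : A = B := by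
  obtain ⟨x, hx⟩ := π.nonempty_of_mem_parts A.2
  exact Subtype.ext (π.eq_of_mem_parts A.2 B.2 hx (h hx))

theorem le_refl' (α : P.Partition n) : α ≤ α := by
  refine ⟨le_rfl, fun B => ⟨1, fun _ => B, Function.injective_of_subsingleton _, fun A => ?_,
    P.one, Equiv.uniqueSigma fun _ : Fin 1 => Fin (B : Finset (Fin n)).card, fun i x => ?_,
    (P.one_comp _).symm⟩⟩
  constructor
  · rintro ⟨_, rfl⟩
    exact subset_rfl
  · intro h
    exact ⟨0, (eq_of_subset _ A B h).symm⟩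
  · obtain rfl := Subsingleton.elim i 0
    rfl

theorem le_trans' {α β γ : P.Partition n} (h₁ : α ≤ β) (h₂ : β ≤ γ) : α ≤ γ := by
  refine ⟨h₁.1.trans h₂.1, fun C => ?_⟩
  obtain ⟨t, b, hb, hbC, p, e₂, he₂, hp⟩ := h₂.2 C
  choose l a ha haB hrest using fun i => h₁.2 (b i)
  let f : (Σ i : Fin t, Fin (l i)) ≃ Fin (∑ i, l i) := finSigmaFinEquiv
  let A : Fin (∑ i, l i) → α.part.parts := fun x => a (f.symm x).1 (f.symm x).2
  have hA : ∀ i j, A (f ⟨i, j⟩) = a i j := fun i j => by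
    have h : f.symm (f ⟨i, j⟩) = ⟨i, j⟩ := f.symm_apply_apply _
    simp only [A]
    rw [h]
  have hA' : ∀ i, a i = fun j => A (f ⟨i, j⟩) := fun i => funext fun j => (hA i j).symm
  have hrest' : ∀ i, ∃ (q : P.Op (l i))
      (e : (Σ j, Fin (A (f ⟨i, j⟩) : Finset (Fin n)).card) ≃ Fin (b i : Finset (Fin n)).card),
      (∀ j x, (b i : Finset (Fin n)).orderEmbOfFin rfl (e ⟨j, x⟩) =
        (A (f ⟨i, j⟩) : Finset (Fin n)).orderEmbOfFin rfl x) ∧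
      β.dec (b i) = P.comp (fun j => (A (f ⟨i, j⟩) : Finset (Fin n)).card) e q
        (fun j => α.dec (A (f ⟨i, j⟩))) := by
    intro i
    have := hrest i
    rw [hA' i] at this
    exact this
  choose q e₁ he₁ hq using hrest'
  let e : (Σ x, Fin (A x : Finset (Fin n)).card) ≃ Fin (C : Finset (Fin n)).card :=
    (Equiv.sigmaCongrLeft (β := fun x => Fin (A x : Finset (Fin n)).card) f).symm.trans
      ((Equiv.sigmaAssoc fun i j => Fin (A (f ⟨i, j⟩) : Finset (Fin n)).card).trans
        ((Equiv.sigmaCongrRight e₁).trans e₂))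
  have he : ∀ i j x, e ⟨f ⟨i, j⟩, x⟩ = e₂ ⟨i, e₁ i ⟨j, x⟩⟩ := by
    intro i j x
    have : (Equiv.sigmaCongrLeft (β := fun x => Fin (A x : Finset (Fin n)).card) f).symm
        ⟨f ⟨i, j⟩, x⟩ = ⟨⟨i, j⟩, x⟩ := by
      rw [Equiv.symm_apply_eq]
      rfl
    simp only [e, Equiv.trans_apply, this]
    rfl
  refine ⟨_, A, ?_, ?_, P.comp l f p q, e, ?_, ?_⟩
  · intro x y hxy
    obtain ⟨⟨i, j⟩, rfl⟩ := f.surjective x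
    obtain ⟨⟨i', j'⟩, rfl⟩ := f.surjective y
    rw [hA, hA] at hxy
    have h1 : (a i j : Finset (Fin n)) ⊆ b i := (haB i _).1 ⟨j, rfl⟩
    have h2 : (a i j : Finset (Fin n)) ⊆ b i' := by
      rw [hxy]
      exact (haB i' _).1 ⟨j', rfl⟩
    obtain ⟨x, hx⟩ := α.part.nonempty_of_mem_parts (a i j).2
    have h3 : b i = b i' :=
      Subtype.ext (β.part.eq_of_mem_parts (b i).2 (b i').2 (h1 hx) (h2 hx))
    obtain rfl := hb h3
    rw [ha i hxy]
  · intro A₀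
    constructor
    · rintro ⟨x, rfl⟩
      obtain ⟨⟨i, j⟩, rfl⟩ := f.surjective x
      rw [hA]
      exact ((haB i _).1 ⟨j, rfl⟩).trans ((hbC _).1 ⟨i, rfl⟩)
    · intro h
      obtain ⟨B, hB, hAB⟩ := h₁.1 A₀.2
      obtain ⟨C', hC', hBC⟩ := h₂.1 hB
      obtain ⟨x, hx⟩ := α.part.nonempty_of_mem_parts A₀.2
      have hCC : C' = C := γ.part.eq_of_mem_parts hC' C.2 (hBC (hAB hx)) (h hx)
      subst hCC
      obtain ⟨i, hi⟩ := (hbC ⟨B, hB⟩).2 hBC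
      obtain ⟨j, hj⟩ := (haB i A₀).2 (by rw [hi]; exact hAB)
      exact ⟨f ⟨i, j⟩, by rw [hA, hj]⟩
  · intro x y
    obtain ⟨⟨i, j⟩, rfl⟩ := f.surjective x
    rw [he, he₂, he₁]
  · rw [P.assoc l f _ e _ e₁ e₂ (fun i j x => (he i j x).symm), hp]
    congr 1
    exact funext hq

instance : Preorder (P.Partition n) where
  le_refl := le_refl'
  le_trans _ _ _ := le_trans'

theorem comp_one_aux {k N : ℕ} (m : Fin k → ℕ) (hm : ∀ i, m i = 1)
    (e : (Σ i, Fin (m i)) ≃ Fin N) (h : k = N) (he : ∀ i x, (e ⟨i, x⟩ : ℕ) = i) (p : P.Op k) :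
    h ▸ p = P.comp m e p (fun i => (hm i).symm ▸ P.one) := by
  obtain rfl : m = fun _ => 1 := funext hm
  subst h
  obtain rfl : e = Equiv.sigmaUnique (Fin k) fun _ => Fin 1 :=
    Equiv.ext fun ⟨i, x⟩ => Fin.ext (he i x)
  exact (P.comp_one p).symm

/-- The partition into singletons, decorated by the identity. -/
instance : OrderBot (P.Partition n) where
  bot :=
    { part := ⊥
      dec := fun B => (show (B : Finset (Fin n)).card = 1 by
        obtain ⟨x, -, hx⟩ := Finpartition.mem_bot_iff.1 B.2
        rw [← hx, card_singleton]).symm ▸ P.one }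
  bot_le β := by
    refine ⟨bot_le, fun B => ⟨(B : Finset (Fin n)).card,
      fun i => ⟨{(B : Finset (Fin n)).orderEmbOfFin rfl i},
        Finpartition.mem_bot_iff.2 ⟨_, mem_univ _, rfl⟩⟩, ?_, ?_, β.dec B,
        Equiv.sigmaUnique (Fin _) fun _ => Fin 1, ?_, ?_⟩⟩
    · intro i j hij
      simpa using hij
    · rintro ⟨A, hA⟩
      obtain ⟨x, -, rfl⟩ := Finpartition.mem_bot_iff.1 hA
      simp only [singleton_subset_iff, Set.mem_range, Subtype.mk.injEq, singleton_inj]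
      rw [← Finset.mem_coe, ← Finset.range_orderEmbOfFin (B : Finset (Fin n)) rfl]
      rfl
    · intro i x
      exact (mem_singleton.1 (Finset.orderEmbOfFin_mem _ rfl x)).symm
    · exact comp_one_aux _ (fun _ => card_singleton _) _ rfl (fun _ _ => rfl) _

theorem le_antisymm' [P.IsReduced] {α β : P.Partition n} (h₁ : α ≤ β) (h₂ : β ≤ α) : α = β := by
  obtain ⟨π, u⟩ := α
  obtain ⟨π', v⟩ := β
  obtain rfl : π = π' := le_antisymm h₁.1 h₂.1
  congr 1
  funext B
  obtain ⟨t, a, ha, haB, p, e, he, hp⟩ := h₁.2 B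
  have haB' : ∀ i, a i = B := fun i => eq_of_subset π _ _ ((haB _).1 ⟨i, rfl⟩)
  obtain rfl : a = fun _ => B := funext haB'
  obtain ⟨i₀, -⟩ := (haB B).2 subset_rfl
  obtain rfl : t = 1 := by
    have h1 : Fintype.card (Fin t) ≤ 1 := Fintype.card_le_one_iff.2 fun i j => ha rfl
    have h2 := i₀.2
    simp only [Fintype.card_fin] at h1
    omega
  obtain rfl := IsReduced.eq_one p
  obtain rfl : e = Equiv.uniqueSigma fun _ : Fin 1 => Fin (B : Finset (Fin n)).card := by
    ext ⟨i, x⟩ : 1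
    obtain rfl := Subsingleton.elim i 0
    exact ((B : Finset (Fin n)).orderEmbOfFin rfl).injective (he _ _)
  exact (hp.trans (P.one_comp _)).symm

instance [P.IsReduced] : PartialOrder (P.Partition n) where
  le_antisymm _ _ := le_antisymm'

/-- The `P`-partition underlying a partition decorated by two totally compatible structures. -/
def forgetWeights (γ : P.tc.Partition n) : P.Partition n where
  part := γ.part
  dec B := (γ.dec B).1

/-- The weighted partition underlying a partition decorated by two totally compatible structures. -/
def weights (γ : P.tc.Partition n) : tcCom.Partition n where
  part := γ.part
  dec B := (γ.dec B).2

end Partition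

end SetOperad

/-! ### Fiber products, semimodularity and CL-shellability -/

/-- The fiber product of posets over `f` and `g`, with the order induced by `A × B`. -/
abbrev FiberProduct {A B S : Type*} (f : A → S) (g : B → S) : Type _ :=
  {x : A × B // f x.1 = g x.2}

/-- Bounded posets. -/
def IsBoundedPoset (Q : Type*) [PartialOrder Q] : Prop :=
  (∃ x : Q, IsBot x) ∧ ∃ x : Q, IsTop x

/-- Semimodular finite posets. -/
def IsSemimodularPoset (Q : Type*) [PartialOrder Q] : Prop :=
  Finite Q ∧ IsBoundedPoset Q ∧
    ∀ ν κ ξ : Q, κ ≠ ξ → ν ⋖ κ → ν ⋖ ξ → ∃ ω, κ ⋖ ω ∧ ξ ⋖ ω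

/-- Totally semimodular finite posets. -/
def IsTotallySemimodular (Q : Type*) [PartialOrder Q] : Prop :=
  Finite Q ∧ IsBoundedPoset Q ∧ ∀ ζ ξ : Q, ζ ≤ ξ → IsSemimodularPoset (Set.Icc ζ ξ)

/-- Maximal chains with `r` edges in a finite bounded poset. -/
structure MaximalChain (Q : Type*) [PartialOrder Q] (r : ℕ) where
  vertex : Fin (r + 1) → Q
  isBot : IsBot (vertex 0)
  isTop : IsTop (vertex (Fin.last r))
  covBy : ∀ i : Fin r, vertex i.castSucc ⋖ vertex i.succ

namespace MaximalChain

variable {Q : Type*} [PartialOrder Q] {r : ℕ}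

/-- Let `x` and `y` be the vertices of `c` of rank `s` and `t`. The part of `b` between these ranks
is a maximal chain of the interval `[x, y]`, and `b` agrees with `c` from the bottom up to `x`. So
`b` represents a maximal chain of the rooted interval `[x, y]` whose root is the part of `c`
below `x`. -/
def InRootedInterval (c : MaximalChain Q r) (s t : Fin (r + 1)) (b : MaximalChain Q r) : Prop :=
  (∀ j ≤ s, b.vertex j = c.vertex j) ∧ b.vertex t = c.vertex t

/-- The labels of `b` increase weakly between the ranks `s` and `t`. -/
def IsRising (lab : MaximalChain Q r → Fin r → ℤ) (s t : Fin (r + 1)) (b : MaximalChain Q r) :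
    Prop :=
  ∀ i j : Fin r, s ≤ i.castSucc → i ≤ j → j.succ ≤ t → lab b i ≤ lab b j

/-- Between the ranks `s` and `t` the word of labels of `a` is lexicographically smaller than that
of `b`. -/
def LexLT (lab : MaximalChain Q r → Fin r → ℤ) (s t : Fin (r + 1)) (a b : MaximalChain Q r) :
    Prop :=
  ∃ i : Fin r, s ≤ i.castSucc ∧ i.succ ≤ t ∧ lab a i < lab b i ∧
    ∀ j < i, s ≤ j.castSucc → lab a j = lab b j

/-- CL-labelings: labelings of the edges of the maximal chains such that chains that coincide along
their first edges have the same labels there, and such that every rooted interval has a unique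
rising maximal chain, which comes lexicographically before all its other maximal chains. -/
structure IsCLLabeling (lab : MaximalChain Q r → Fin r → ℤ) : Prop where
  coherent : ∀ (b c : MaximalChain Q r) (d : Fin r),
    (∀ j ≤ d.succ, b.vertex j = c.vertex j) → lab b d = lab c d
  rooted : ∀ (c : MaximalChain Q r) (s t : Fin (r + 1)), s < t →
    ∃ a, InRootedInterval c s t a ∧ IsRising lab s t a ∧
      ∀ b, InRootedInterval c s t b → (∃ j, s ≤ j ∧ j ≤ t ∧ b.vertex j ≠ a.vertex j) →
        ¬ IsRising lab s t b ∧ LexLT lab s t a b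

end MaximalChain

/-- CL-shellable posets: finite, bounded and graded posets (all maximal chains have the same
length) that admit a CL-labeling. -/
def IsCLShellable (Q : Type*) [PartialOrder Q] : Prop :=
  Finite Q ∧ IsBoundedPoset Q ∧
    ∃ r : ℕ, (∀ r', Nonempty (MaximalChain Q r') → r' = r) ∧
      ∃ lab : MaximalChain Q r → Fin r → ℤ, MaximalChain.IsCLLabeling lab

/-! A composite in a Hadamard product is a pair of composites of the same blocks. So the order on
doubly decorated partitions is the order of `P`-partitions together with the condition that, on each
block `D` of the larger partition, the gain in weight lies in `{0, …, t - 1}`, where `t` blocks are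
merged into `D` (`tc_le_iff`). Since decorations and weights can be paired freely, this gives the
fiber product.

For shellability the covers are given a recursive atom ordering in the sense of Björner and Wachs.
Weak associativity allows a tree to be rotated until two chosen leaves are adjacent
(`exists_adjacent`). Hence two blocks inside one block of `Z ≥ X` can be merged without leaving `[X,
Z]` (`exists_merge`), covers are merges of two blocks, and the poset is graded by the number of
blocks. The covers of an element are ranked by the least element of the merged block, `mergeKey`.

Intervals of weighted partitions need not be semimodular: two disjoint merges inside one block of
`Z` may together gain more weight than `Z` permits. This is the only obstruction. If the merged
blocks meet, or lie in different blocks of `Z`, total semimodularity downstairs gives an unweighted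
common cover (a further merge does so if only the weights differ), and it can be weighted below `Z`.
Otherwise the merge of smaller key is replaced by one that joins the block of its least element to a
block of the other merge: the key is still smaller and the merged blocks now meet
(`exists_common_cover_or`). A recursive atom ordering asks for no more, and `isCLShellable_of_key`
turns the ranking into a CL-labeling. -/

/-! ### CL-labelings from a ranking of the covers -/

section RootedLabel

variable {Q : Type*} [PartialOrder Q]

open Classical in
/-- A label for the edge from `v d` to `v (d + 1)` of a chain `v`: the covers of `v (d + 1)` that also
cover an element preceding `v (d + 1)` in the order of the covers of `v d` receive smaller labels
than the edge from `v d` to `v (d + 1)`, the others receive larger ones. -/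
noncomputable def rootedLabel (M : ℤ) (ι : Q → Q → ℤ) : ℕ → (ℕ → Q) → ℤ
  | 0, v => ι (v 0) (v 1)
  | d + 1, v => rootedLabel M ι d v + ι (v (d + 1)) (v (d + 2)) +
      -- As long as `0 ≤ ι < M`, the sign of `ι - M` or `ι + 1` is known, so a descent of the labels
      -- records exactly that an earlier cover of `v d` lies below `v (d + 2)`.
      if ∃ x, v d ⋖ x ∧ x ⋖ v (d + 2) ∧
        rootedLabel M ι d (Function.update v (d + 1) x) < rootedLabel M ι d v then -M else 1

/-- The element `y` covers an element that precedes `v (d + 1)` in the order of the covers of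
`v d`. -/
def CoversEarlier (M : ℤ) (ι : Q → Q → ℤ) (d : ℕ) (v : ℕ → Q) (y : Q) : Prop :=
  ∃ x, v d ⋖ x ∧ x ⋖ y ∧
    rootedLabel M ι d (Function.update v (d + 1) x) < rootedLabel M ι d v

variable {M : ℤ} {ι : Q → Q → ℤ}

open Classical in
theorem rootedLabel_congr {d : ℕ} {v w : ℕ → Q} (h : ∀ j ≤ d + 1, v j = w j) :
    rootedLabel M ι d v = rootedLabel M ι d w := by
  induction d generalizing v w with
  | zero => simp only [rootedLabel, h 0 (by omega), h 1 (by omega)]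
  | succ d ih =>
    have h1 : rootedLabel M ι d v = rootedLabel M ι d w := ih fun j hj => h j (by omega)
    have h2 : ∀ x, rootedLabel M ι d (Function.update v (d + 1) x) =
        rootedLabel M ι d (Function.update w (d + 1) x) := fun x => ih fun j hj => by
      by_cases hjd : j = d + 1
      · subst hjd; simp
      · simp [hjd, h j (by omega)]
    rw [rootedLabel, rootedLabel, h1, h (d + 1) (by omega), h (d + 2) (by omega)]
    congr 1
    refine if_congr ?_ rfl rfl
    simp only [h2, h d (by omega)]

theorem rootedLabel_succ_lt (hι : ∀ x y, ι x y < M) {d : ℕ} {v : ℕ → Q}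
    (h : CoversEarlier M ι d v (v (d + 2))) :
    rootedLabel M ι (d + 1) v < rootedLabel M ι d v := by
  unfold CoversEarlier at h
  rw [rootedLabel, if_pos h]
  have := hι (v (d + 1)) (v (d + 2))
  omega

theorem lt_rootedLabel_succ (hι : ∀ x y, 0 ≤ ι x y) {d : ℕ} {v : ℕ → Q}
    (h : ¬ CoversEarlier M ι d v (v (d + 2))) :
    rootedLabel M ι d v < rootedLabel M ι (d + 1) v := by
  unfold CoversEarlier at h
  rw [rootedLabel, if_neg h]
  have := hι (v (d + 1)) (v (d + 2))
  omega

theorem rootedLabel_update_of_lt {d e : ℕ} (h : d + 1 < e) (v : ℕ → Q) (y : Q) :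
    rootedLabel M ι d (Function.update v e y) = rootedLabel M ι d v :=
  rootedLabel_congr fun j hj => by
    rw [Function.update_of_ne]
    omega

theorem coversEarlier_update {d : ℕ} {v : ℕ → Q} {y z : Q} :
    CoversEarlier M ι d (Function.update v (d + 2) y) z ↔ CoversEarlier M ι d v z := by
  unfold CoversEarlier
  have h1 : Function.update v (d + 2) y d = v d := by
    rw [Function.update_of_ne]
    omega
  have h2 : ∀ x, rootedLabel M ι d (Function.update (Function.update v (d + 2) y) (d + 1) x) =
      rootedLabel M ι d (Function.update v (d + 1) x) := fun x => by
    rw [Function.update_comm (by omega), rootedLabel_update_of_lt (by omega)]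
  simp only [h1, h2, rootedLabel_update_of_lt (show d + 1 < d + 2 by omega)]

open Classical in
theorem rootedLabel_succ_update (d : ℕ) (v : ℕ → Q) (y : Q) :
    rootedLabel M ι (d + 1) (Function.update v (d + 2) y) =
      rootedLabel M ι d v + ι (v (d + 1)) y + if CoversEarlier M ι d v y then -M else 1 := by
  have h := coversEarlier_update (M := M) (ι := ι) (d := d) (v := v) (y := y) (z := y)
  unfold CoversEarlier at h
  rw [rootedLabel, rootedLabel_update_of_lt (by omega)]
  simp only [rootedLabel_update_of_lt (show d + 1 < d + 2 by omega), Function.update_self] at h ⊢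
  rw [Function.update_of_ne (by omega)]
  congr 1
  exact if_congr h rfl rfl

/-- Two covers of the same type, both early or both late, are told apart by `ι`; covers of different
types get labels on different sides of the preceding label. -/
theorem rootedLabel_injective (hι0 : ∀ x y, 0 ≤ ι x y) (hι : ∀ x y, ι x y < M)
    (hinj : ∀ x, Function.Injective (ι x)) {d : ℕ} {v : ℕ → Q} {y y' : Q}
    (h : rootedLabel M ι d (Function.update v (d + 1) y) =
      rootedLabel M ι d (Function.update v (d + 1) y')) : y = y' := by
  cases d with
  | zero =>
    simp only [rootedLabel, zero_add, Function.update_self] at h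
    rw [Function.update_of_ne (by omega), Function.update_of_ne (by omega)] at h
    exact hinj _ h
  | succ d =>
    rw [rootedLabel_succ_update, rootedLabel_succ_update] at h
    have h1 := hι0 (v (d + 1)) y
    have h2 := hι0 (v (d + 1)) y'
    have h3 := hι (v (d + 1)) y
    have h4 := hι (v (d + 1)) y'
    apply hinj (v (d + 1))
    split_ifs at h <;> omega

/-- Moving the early covers to the front does not disturb the ranking by `key`: by `h₁` every early
cover has key at most `key x₀ x`, and by `h₂` every cover of key below `key x₀ x` is early. Only
covers of equal key can be reordered. -/
theorem rootedLabel_strictMono_key (hι0 : ∀ x y, 0 ≤ ι x y) (hι : ∀ x y, ι x y < M)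
    {key : Q → Q → ℕ} (hkey : ∀ x y y', key x y < key x y' → ι x y < ι x y')
    (h₁ : ∀ x₀ x x' y, x₀ ⋖ x → x ⋖ y → x₀ ⋖ x' → x' ⋖ y → x ≠ x' → key x₀ x' ≤ key x₀ x →
      key x y ≤ key x₀ x)
    (h₂ : ∀ x₀ x y, x₀ ⋖ x → x ⋖ y → key x y < key x₀ x →
      ∃ x', x₀ ⋖ x' ∧ x' ⋖ y ∧ key x₀ x' < key x₀ x)
    {d : ℕ} {v : ℕ → Q} (hv : ∀ i < d, v i ⋖ v (i + 1)) {y y' : Q} (hy : v d ⋖ y) (hy' : v d ⋖ y')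
    (h : key (v d) y < key (v d) y') :
    rootedLabel M ι d (Function.update v (d + 1) y) <
      rootedLabel M ι d (Function.update v (d + 1) y') := by
  induction d generalizing v y y' with
  | zero =>
    simp only [rootedLabel, zero_add, Function.update_self]
    rw [Function.update_of_ne (by omega), Function.update_of_ne (by omega)]
    exact hkey _ _ _ h
  | succ d ih =>
    have hlt : ∀ x', v d ⋖ x' → key (v d) x' < key (v d) (v (d + 1)) →
        rootedLabel M ι d (Function.update v (d + 1) x') < rootedLabel M ι d v := by
      intro x' hx' hk
      have := ih (fun i hi => hv i (by omega)) hx' (hv d (by omega)) hk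
      rwa [Function.update_eq_self] at this
    have hle : ∀ x', v d ⋖ x' →
        rootedLabel M ι d (Function.update v (d + 1) x') < rootedLabel M ι d v →
        key (v d) x' ≤ key (v d) (v (d + 1)) := by
      intro x' hx' hl
      by_contra! hk
      have := ih (fun i hi => hv i (by omega)) (hv d (by omega)) hx' hk
      rw [Function.update_eq_self] at this
      omega
    rw [rootedLabel_succ_update, rootedLabel_succ_update]
    have e1 := hι0 (v (d + 1)) y
    have e2 := hι0 (v (d + 1)) y'
    have e3 := hι (v (d + 1)) y
    have e4 := hι (v (d + 1)) y'
    have e5 := hkey _ _ _ h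
    -- The sole danger is that `y'` is early while `y`, of smaller key, is not.
    have key1 : CoversEarlier M ι d v y' → CoversEarlier M ι d v y := by
      rintro ⟨x', hx, hxy, hl⟩
      have hne : v (d + 1) ≠ x' := by
        rintro rfl
        rw [Function.update_eq_self] at hl
        exact lt_irrefl _ hl
      have hk := h₁ _ _ _ _ (hv d (by omega)) hy' hx hxy hne (hle _ hx hl)
      obtain ⟨x'', hx1, hx2, hx3⟩ := h₂ _ _ _ (hv d (by omega)) hy (h.trans_le hk)
      exact ⟨x'', hx1, hx2, hlt _ hx1 hx3⟩
    split_ifs <;> first | omega | (exfalso; tauto)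

/-! ### Greedy chains and rising chains -/

/-- The edge from `v d` to `v (d + 1)` has the least label among the edges towards `z`. -/
def IsLeastStep (M : ℤ) (ι : Q → Q → ℤ) (z : Q) (d : ℕ) (v : ℕ → Q) : Prop :=
  ∀ y, v d ⋖ y → y ≤ z →
    rootedLabel M ι d v ≤ rootedLabel M ι d (Function.update v (d + 1) y)

theorem isLeastStep_congr {z : Q} {d : ℕ} {v w : ℕ → Q} (h : ∀ j ≤ d + 1, v j = w j) :
    IsLeastStep M ι z d v ↔ IsLeastStep M ι z d w := by
  have h2 : ∀ y, rootedLabel M ι d (Function.update v (d + 1) y) =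
      rootedLabel M ι d (Function.update w (d + 1) y) := fun y => rootedLabel_congr fun j hj => by
    by_cases hjd : j = d + 1
    · subst hjd; simp
    · simp [hjd, h j (by omega)]
  unfold IsLeastStep
  rw [h d (by omega), rootedLabel_congr h]
  simp only [h2]

theorem rank_strictMono [Finite Q] {rk : Q → ℕ} (hrk : ∀ x y : Q, x ⋖ y → rk y = rk x + 1) :
    StrictMono rk := by
  intro x y hxy
  induction x using WellFoundedGT.induction with
  | _ x ih =>
    obtain ⟨x', hx, hxy'⟩ := exists_covBy_le_of_lt hxy
    have := hrk _ _ hx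
    rcases hxy'.eq_or_lt with rfl | hlt
    · omega
    · have := ih x' hx.lt hlt
      omega

/-- This will be the rising chain of a rooted interval. The bound `hk` on the rank ensures that `z`
is not reached too soon, so there is always a next step. -/
theorem exists_greedy_chain [Finite Q] {s : ℕ} {v : ℕ → Q} {z : Q} {rk : Q → ℕ}
    (hrk : ∀ x y : Q, x ⋖ y → rk y = rk x + 1) (k : ℕ) (hz : v s ≤ z)
    (hk : rk (v s) + k ≤ rk z) :
    ∃ a : ℕ → Q, (∀ j ≤ s, a j = v j) ∧ a (s + k) ≤ z ∧ rk (a (s + k)) = rk (v s) + k ∧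
      ∀ d, s ≤ d → d < s + k → a d ⋖ a (d + 1) ∧ IsLeastStep M ι z d a := by
  induction k with
  | zero => exact ⟨v, fun _ _ => rfl, hz, rfl, fun d h1 h2 => by omega⟩
  | succ k ih =>
    obtain ⟨a, ha, haz, har, hd⟩ := ih (by omega)
    have hlt : a (s + k) < z := lt_of_le_of_ne haz fun h => by rw [h] at har; omega
    have hne : {y | a (s + k) ⋖ y ∧ y ≤ z}.Nonempty := exists_covBy_le_of_lt hlt
    obtain ⟨y, ⟨hy1, hy2⟩, hmin⟩ := Set.exists_min_image _
      (fun y => rootedLabel M ι (s + k) (Function.update a (s + k + 1) y)) (Set.toFinite _) hne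
    have hsame : ∀ j ≤ s + k, Function.update a (s + k + 1) y j = a j := fun j hj => by
      rw [Function.update_of_ne]
      omega
    refine ⟨Function.update a (s + k + 1) y, fun j hj => ?_, ?_, ?_, fun d h1 h2 => ?_⟩
    · rw [hsame j (by omega), ha j hj]
    · rw [← add_assoc, Function.update_self]
      exact hy2
    · rw [← add_assoc, Function.update_self, hrk _ _ hy1, har]
      omega
    · rcases Nat.lt_or_ge d (s + k) with hdk | hdk
      · rw [hsame d (by omega), hsame (d + 1) (by omega),
          isLeastStep_congr (fun j hj => hsame j (by omega))]
        exact hd d h1 hdk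
      · obtain rfl : d = s + k := by omega
        rw [hsame _ le_rfl, Function.update_self]
        refine ⟨hy1, fun y' hy' hyz => ?_⟩
        rw [hsame _ le_rfl] at hy'
        rw [Function.update_idem]
        exact hmin y' ⟨hy', hyz⟩

/-- A weakly increasing chain takes the least possible step everywhere. -/
theorem isLeastStep_of_rising {rk : Q → ℕ} (hrk : ∀ x y : Q, x ⋖ y → rk y = rk x + 1)
    (hmono : StrictMono rk) (hι : ∀ x y, ι x y < M)
    (hex : ∀ (d : ℕ) (v : ℕ → Q) (y z : Q), (∀ i ≤ d, v i ⋖ v (i + 1)) → v d ⋖ y → v (d + 1) ≤ z →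
      y ≤ z → rootedLabel M ι d (Function.update v (d + 1) y) < rootedLabel M ι d v →
      ∃ y' w, v d ⋖ y' ∧ rootedLabel M ι d (Function.update v (d + 1) y') < rootedLabel M ι d v ∧
        y' ⋖ w ∧ v (d + 1) ⋖ w ∧ w ≤ z)
    {v : ℕ → Q} {s t : ℕ} (hv : ∀ i < t, v i ⋖ v (i + 1))
    (hrise : ∀ d, s ≤ d → d + 1 < t → rootedLabel M ι d v ≤ rootedLabel M ι (d + 1) v)
    (hle : ∀ d ≤ t, v d ≤ v t)
    {d : ℕ} (hsd : s ≤ d) (hdt : d < t) : IsLeastStep M ι (v t) d v := by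
  obtain ⟨k, hk⟩ : ∃ k, d + k + 1 = t := ⟨t - d - 1, by omega⟩
  induction k generalizing d with
  | zero =>
    intro y hy hyt
    -- On the last edge there is no choice: `y ≤ v t` has the rank of `v t`.
    have : y = v (d + 1) := by
      have h1 := hrk _ _ hy
      have h2 := hrk _ _ (hv d hdt)
      obtain rfl : d + 1 = t := by omega
      by_contra hne
      have := hmono (lt_of_le_of_ne hyt hne)
      omega
    rw [this, Function.update_eq_self]
  | succ k ih =>
    intro y hy hyt
    by_contra! hlt
    -- An earlier `y'` with a common cover `w` makes `w` an early cover of `v (d + 1)`, so the edge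
    -- to `w` has a label below that of step `d`. But step `d + 1` is least by induction and not
    -- below step `d`.
    obtain ⟨y', w, hy', hl, hyw, hvw, hw⟩ := hex d v y (v t) (fun i hi => hv i (by omega)) hy
      (hle _ (by omega)) hyt hlt
    have hmin := ih (d := d + 1) (by omega) (by omega) (by omega) w hvw hw
    have hr := hrise d hsd (by omega)
    have : rootedLabel M ι (d + 1) (Function.update v (d + 1 + 1) w) <
        rootedLabel M ι d (Function.update v (d + 1 + 1) w) := by
      refine rootedLabel_succ_lt hι ?_
      rw [Function.update_self, coversEarlier_update]
      exact ⟨y', hy', hyw, hl⟩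
    rw [rootedLabel_update_of_lt (show d + 1 < d + 1 + 1 by omega)] at this
    omega

/-- A descent would exhibit an earlier cover of `v d` below `v (d + 2) ≤ z`, against the choice of a
least step. -/
theorem le_rootedLabel_succ_of_isLeastStep (hι : ∀ x y, 0 ≤ ι x y) {v : ℕ → Q} {z : Q} {d : ℕ}
    (hz : v (d + 2) ≤ z) (h : IsLeastStep M ι z d v) :
    rootedLabel M ι d v ≤ rootedLabel M ι (d + 1) v := by
  refine (lt_rootedLabel_succ hι ?_).le
  rintro ⟨x, hx, hxy, hl⟩
  exact absurd (h x hx (hxy.le.trans hz)) (not_le.2 hl)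

/-! ### Maximal chains as sequences and the CL-labeling -/

namespace MaximalChain

variable {r : ℕ}

/-- The vertices of a maximal chain as a sequence. -/
def toSeq (c : MaximalChain Q r) (d : ℕ) : Q := c.vertex ⟨min d r, by omega⟩

theorem toSeq_apply (c : MaximalChain Q r) (i : Fin (r + 1)) : c.toSeq i = c.vertex i :=
  congrArg c.vertex (Fin.ext (min_eq_left (by omega)))

theorem toSeq_of_le (c : MaximalChain Q r) {d : ℕ} (h : d ≤ r) :
    c.toSeq d = c.vertex ⟨d, by omega⟩ :=
  congrArg c.vertex (Fin.ext (min_eq_left h))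

theorem toSeq_covBy (c : MaximalChain Q r) {d : ℕ} (h : d < r) :
    c.toSeq d ⋖ c.toSeq (d + 1) := by
  rw [c.toSeq_of_le h.le, c.toSeq_of_le (show d + 1 ≤ r from h)]
  exact c.covBy ⟨d, h⟩

theorem toSeq_mono (c : MaximalChain Q r) {d e : ℕ} (h : d ≤ e) (he : e ≤ r) :
    c.toSeq d ≤ c.toSeq e := by
  induction e, h using Nat.le_induction with
  | base => exact le_rfl
  | succ e hde ih => exact (ih (by omega)).trans (c.toSeq_covBy he).le

/-- A maximal chain from a sequence. -/
def ofSeq (v : ℕ → Q) (h0 : IsBot (v 0)) (h1 : IsTop (v r)) (hv : ∀ d < r, v d ⋖ v (d + 1)) :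
    MaximalChain Q r where
  vertex i := v i
  isBot := h0
  isTop := h1
  covBy i := hv i i.2

theorem toSeq_ofSeq (v : ℕ → Q) (h0 : IsBot (v 0)) (h1 : IsTop (v r))
    (hv : ∀ d < r, v d ⋖ v (d + 1)) {d : ℕ} (hd : d ≤ r) : (ofSeq v h0 h1 hv).toSeq d = v d := by
  rw [toSeq_of_le _ hd]
  rfl

end MaximalChain

/-- Greedy chains are rising, rising chains are greedy, and injectivity of the labels makes the
greedy chain unique and lexicographically first. The hypothesis `hex` is the exchange axiom of a
recursive atom ordering. -/
theorem MaximalChain.isCLLabeling_rootedLabel [Finite Q] {rk : Q → ℕ} {r : ℕ}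
    (hrk : ∀ x y : Q, x ⋖ y → rk y = rk x + 1)
    (hι0 : ∀ x y, 0 ≤ ι x y) (hι : ∀ x y, ι x y < M) (hinj : ∀ x, Function.Injective (ι x))
    (hex : ∀ (d : ℕ) (v : ℕ → Q) (y z : Q), (∀ i ≤ d, v i ⋖ v (i + 1)) → v d ⋖ y → v (d + 1) ≤ z →
      y ≤ z → rootedLabel M ι d (Function.update v (d + 1) y) < rootedLabel M ι d v →
      ∃ y' w, v d ⋖ y' ∧ rootedLabel M ι d (Function.update v (d + 1) y') < rootedLabel M ι d v ∧
        y' ⋖ w ∧ v (d + 1) ⋖ w ∧ w ≤ z) :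
    IsCLLabeling (fun (c : MaximalChain Q r) i => rootedLabel M ι i c.toSeq) := by
  have hmono := rank_strictMono hrk
  refine ⟨fun b c d h => ?_, fun c s t hst => ?_⟩
  · refine rootedLabel_congr fun j hj => ?_
    have hj' : j ≤ r := by omega
    rw [toSeq_of_le _ hj', toSeq_of_le _ hj']
    exact h ⟨j, by omega⟩ hj
  · have hst' : (s : ℕ) < t := hst
    have htr : (t : ℕ) ≤ r := by omega
    have hrank : ∀ d ≤ r, rk (c.toSeq d) = rk (c.toSeq 0) + d := by
      intro d
      induction d with
      | zero => simp
      | succ d ih =>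
        intro hd
        rw [hrk _ _ (c.toSeq_covBy hd), ih (by omega), add_assoc]
    have hrs := hrank s (by omega)
    have hrt := hrank t (by omega)
    obtain ⟨g, hg, hgz, hgr, hgd⟩ := exists_greedy_chain (M := M) (ι := ι) (s := s) (v := c.toSeq)
      (z := c.toSeq t) hrk (t - s) (c.toSeq_mono hst'.le htr) (by omega)
    rw [Nat.add_sub_cancel' hst'.le] at hgz hgr hgd
    have hgt : g t = c.toSeq t := by
      by_contra hne
      have := hmono (lt_of_le_of_ne hgz hne)
      omega
    -- The greedy piece `g` contains the root up to `s`; above `t` the chain `c` is resumed.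
    let v : ℕ → Q := fun d => if d ≤ t then g d else c.toSeq d
    have hvg : ∀ d ≤ (t : ℕ), v d = g d := fun d hd => if_pos hd
    have hvc : ∀ d ≥ (t : ℕ), v d = c.toSeq d := fun d hd => by
      rcases hd.eq_or_lt with rfl | hlt
      · rw [hvg _ le_rfl, hgt]
      · exact if_neg (by omega)
    have hvs : ∀ d ≤ (s : ℕ), v d = c.toSeq d := fun d hd => by
      rw [hvg d (by omega), hg d hd]
    have hcov : ∀ d < r, v d ⋖ v (d + 1) := by
      intro d hd
      rcases Nat.lt_or_ge d s with h1 | h1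
      · rw [hvs d h1.le, hvs (d + 1) h1]
        exact c.toSeq_covBy hd
      · rcases Nat.lt_or_ge d t with h2 | h2
        · rw [hvg d h2.le, hvg (d + 1) h2]
          exact (hgd d h1 h2).1
        · rw [hvc d h2, hvc (d + 1) (by omega)]
          exact c.toSeq_covBy hd
    have hleast : ∀ d, (s : ℕ) ≤ d → d < t → IsLeastStep M ι (c.toSeq t) d v := fun d h1 h2 => by
      rw [isLeastStep_congr fun j hj => hvg j (by omega)]
      exact (hgd d h1 h2).2
    have h0 : IsBot (v 0) := by
      rw [hvs 0 (by omega), toSeq_of_le _ (by omega)]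
      exact c.isBot
    have h1 : IsTop (v r) := by
      rw [hvc r htr, toSeq_of_le _ le_rfl]
      exact c.isTop
    set a : MaximalChain Q r := ofSeq v h0 h1 hcov
    have hav : ∀ d ≤ r, a.toSeq d = v d := fun d hd => toSeq_ofSeq v h0 h1 hcov hd
    have haleast : ∀ d, (s : ℕ) ≤ d → d < t → IsLeastStep M ι (c.toSeq t) d a.toSeq :=
      fun d h1 h2 => by
        rw [isLeastStep_congr fun j hj => hav j (by omega)]
        exact hleast d h1 h2
    have hat : a.toSeq t = c.toSeq t := by rw [hav t htr, hvc _ le_rfl]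
    have has : ∀ d ≤ (s : ℕ), a.toSeq d = c.toSeq d := fun d hd => by
      rw [hav d (by omega), hvs d hd]
    refine ⟨a, ⟨fun j hj => ?_, ?_⟩, ?_, fun b hb hne => ?_⟩
    · rw [← toSeq_apply, ← toSeq_apply]
      exact has j hj
    · rw [← toSeq_apply, ← toSeq_apply, hat]
    · intro i j hi hij hj
      have hi' : (s : ℕ) ≤ i := hi
      have hij' : (i : ℕ) ≤ j := hij
      have hj' : (j : ℕ) + 1 ≤ t := hj
      show rootedLabel M ι i _ ≤ rootedLabel M ι j _
      generalize (j : ℕ) = e at hij' hj'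
      induction e, hij' using Nat.le_induction with
      | base => exact le_rfl
      | succ e he ih =>
        refine (ih (by omega)).trans (le_rootedLabel_succ_of_isLeastStep hι0 ?_
          (haleast e (by omega) (by omega)))
        rw [← hat]
        exact a.toSeq_mono hj' htr
    · have hbs : ∀ d ≤ (s : ℕ), b.toSeq d = a.toSeq d := fun d hd => by
        rw [has d hd, toSeq_of_le _ (show d ≤ r by omega), toSeq_of_le _ (show d ≤ r by omega)]
        exact hb.1 ⟨d, by omega⟩ hd
      have hbt : b.toSeq t = c.toSeq t := by
        rw [toSeq_apply, toSeq_apply]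
        exact hb.2
      -- At the first vertex where the chains differ, `a` takes the least step, and injectivity
      -- makes the inequality strict.
      have hlex : ∃ d, (s : ℕ) ≤ d ∧ d < t ∧ (∀ j ≤ d, a.toSeq j = b.toSeq j) ∧
          rootedLabel M ι d a.toSeq < rootedLabel M ι d b.toSeq := by
        obtain ⟨j₀, hj₀, hj₀t, hj₀ne⟩ := hne
        have hex' : ∃ j, j ≤ r ∧ b.toSeq j ≠ a.toSeq j :=
          ⟨j₀, by omega, by rw [toSeq_apply, toSeq_apply]; exact hj₀ne⟩
        classical
        obtain ⟨hm1, hm2⟩ := Nat.find_spec hex'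
        have hmin : ∀ j < Nat.find hex', b.toSeq j = a.toSeq j := fun j hj => by
          have := Nat.find_min hex' hj
          push Not at this
          exact this (by omega)
        have hmle : Nat.find hex' ≤ j₀ :=
          Nat.find_min' hex' ⟨by omega, by rw [toSeq_apply, toSeq_apply]; exact hj₀ne⟩
        have hms : (s : ℕ) < Nat.find hex' := by
          by_contra! h
          exact hm2 (hbs _ h)
        have hj₀t' : (j₀ : ℕ) ≤ t := hj₀t
        obtain ⟨d, hd⟩ : ∃ d, Nat.find hex' = d + 1 := ⟨Nat.find hex' - 1, by omega⟩
        rw [hd] at hm1 hm2 hmin hmle hms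
        have hupd : rootedLabel M ι d (Function.update a.toSeq (d + 1) (b.toSeq (d + 1))) =
            rootedLabel M ι d b.toSeq := rootedLabel_congr fun j hj => by
          rcases hj.eq_or_lt with rfl | hlt
          · simp
          · rw [Function.update_of_ne (by omega), hmin j hlt]
        refine ⟨d, by omega, by omega, fun j hj => (hmin j (by omega)).symm, lt_of_le_of_ne ?_ ?_⟩
        · rw [← hupd]
          refine haleast d (by omega) (by omega) _ ?_ ?_
          · rw [← hmin d (by omega)]
            exact b.toSeq_covBy (by omega)
          · rw [← hbt]
            exact b.toSeq_mono (by omega) htr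
        · intro heq
          refine hm2 (rootedLabel_injective hι0 hι hinj (d := d) (v := a.toSeq) ?_)
          rw [hupd, Function.update_eq_self, heq]
      obtain ⟨d, hd1, hd2, hd3, hd4⟩ := hlex
      refine ⟨fun hrise => ?_, ⟨d, by omega⟩, hd1, hd2, hd4, fun j hj _ => ?_⟩
      -- If `b` were rising it would also take a least step at `d`, which the smaller label of `a`
      -- excludes.
      · have hb_least := isLeastStep_of_rising hrk hmono hι hex (v := b.toSeq) (s := s) (t := t)
          (fun i hi => b.toSeq_covBy (by omega))
          (fun e he1 he2 => hrise ⟨e, by omega⟩ ⟨e + 1, by omega⟩ he1 (by simp) he2)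
          (fun e he => b.toSeq_mono he htr) hd1 hd2
        have hupd : rootedLabel M ι d (Function.update b.toSeq (d + 1) (a.toSeq (d + 1))) =
            rootedLabel M ι d a.toSeq := rootedLabel_congr fun j hj => by
          rcases hj.eq_or_lt with rfl | hlt
          · simp
          · rw [Function.update_of_ne (by omega), hd3 j (by omega)]
        have := hb_least (a.toSeq (d + 1))
          (by rw [← hd3 d le_rfl]; exact a.toSeq_covBy (by omega))
          (by rw [hbt, ← hat]; exact a.toSeq_mono (by omega) htr)
        rw [hupd] at this
        omega
      · exact rootedLabel_congr fun i hi => hd3 i (by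
          have : (j : ℕ) < d := hj
          omega)

/-- The key depends on the edge alone, not on the root. Conditions `h₁` and `h₂` keep every rooted
order compatible with it, and `h₃` is the exchange axiom; in its first alternative the earlier cover
itself serves, even when the keys tie. -/
theorem isCLShellable_of_key [Finite Q] (hQ : IsBoundedPoset Q) {rk : Q → ℕ}
    (hrk : ∀ x y : Q, x ⋖ y → rk y = rk x + 1) (key : Q → Q → ℕ)
    (h₁ : ∀ x₀ x x' y, x₀ ⋖ x → x ⋖ y → x₀ ⋖ x' → x' ⋖ y → x ≠ x' → key x₀ x' ≤ key x₀ x →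
      key x y ≤ key x₀ x)
    (h₂ : ∀ x₀ x y, x₀ ⋖ x → x ⋖ y → key x y < key x₀ x →
      ∃ x', x₀ ⋖ x' ∧ x' ⋖ y ∧ key x₀ x' < key x₀ x)
    (h₃ : ∀ x y y' z, x ⋖ y → x ⋖ y' → y ≠ y' → y ≤ z → y' ≤ z → key x y ≤ key x y' →
      (∃ w ≤ z, y ⋖ w ∧ y' ⋖ w) ∨
        ∃ y'', x ⋖ y'' ∧ key x y'' < key x y' ∧ ∃ w ≤ z, y'' ⋖ w ∧ y' ⋖ w) :
    IsCLShellable Q := by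
  refine ⟨inferInstance, hQ, ?_⟩
  obtain ⟨⟨b, hb⟩, ⟨t, ht⟩⟩ := hQ
  refine ⟨rk t - rk b, ?_, ?_⟩
  · rintro r ⟨c⟩
    have hrank : ∀ d ≤ r, rk (c.toSeq d) = rk (c.toSeq 0) + d := by
      intro d
      induction d with
      | zero => simp
      | succ d ih =>
        intro hd
        rw [hrk _ _ (c.toSeq_covBy hd), ih (by omega), add_assoc]
    have h := hrank r le_rfl
    rw [c.toSeq_of_le le_rfl, c.toSeq_of_le (Nat.zero_le _)] at h
    have h0 : c.vertex ⟨0, by omega⟩ = b := le_antisymm (c.isBot b) (hb _)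
    have h1 : c.vertex ⟨r, by omega⟩ = t := le_antisymm (ht _) (c.isTop t)
    rw [h0, h1] at h
    omega
  · have := Fintype.ofFinite Q
    let idx := Fintype.equivFin Q
    -- Lexicographic encoding: the key first, with ties broken by an arbitrary enumeration of `Q`.
    let ι : Q → Q → ℤ := fun x y => ((key x y * Fintype.card Q + idx y : ℕ) : ℤ)
    obtain ⟨B, hB⟩ : ∃ B : ℤ, ∀ x y, ι x y < B := by
      obtain ⟨B, hB⟩ := (Set.finite_range fun p : Q × Q => ι p.1 p.2).bddAbove
      exact ⟨B + 1, fun x y => Int.lt_add_one_of_le (hB ⟨(x, y), rfl⟩)⟩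
    have hι0 : ∀ x y, 0 ≤ ι x y := fun x y => Int.natCast_nonneg _
    have hkey : ∀ x y y', key x y < key x y' → ι x y < ι x y' := by
      intro x y y' h
      have h1 := (idx y).2
      have h2 := Nat.mul_le_mul_right (Fintype.card Q) (Nat.succ_le_of_lt h)
      rw [Nat.succ_mul] at h2
      simp only [ι, Int.ofNat_lt]
      omega
    have hinj : ∀ x, Function.Injective (ι x) := by
      intro x y y' h
      rcases lt_trichotomy (key x y) (key x y') with h' | h' | h'
      · exact absurd h (hkey _ _ _ h').ne
      · simp only [ι, h', Nat.cast_inj, Nat.add_left_cancel_iff] at h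
        exact idx.injective (Fin.ext h)
      · exact absurd h (hkey _ _ _ h').ne'
    refine ⟨_, MaximalChain.isCLLabeling_rootedLabel hrk hι0 hB hinj ?_⟩
    intro d v y z hv hy hvz hyz hlt
    have hmono : ∀ {y y'}, v d ⋖ y → v d ⋖ y' → key (v d) y < key (v d) y' →
        rootedLabel B ι d (Function.update v (d + 1) y) <
          rootedLabel B ι d (Function.update v (d + 1) y') :=
      rootedLabel_strictMono_key hι0 hB hkey h₁ h₂ (fun i hi => hv i hi.le)
    have hvd := hv d le_rfl
    have hne : y ≠ v (d + 1) := by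
      rintro rfl
      rw [Function.update_eq_self] at hlt
      exact lt_irrefl _ hlt
    have hle : key (v d) y ≤ key (v d) (v (d + 1)) := by
      by_contra! hk
      have := hmono hvd hy hk
      rw [Function.update_eq_self] at this
      omega
    rcases h₃ _ _ _ z hy hvd hne hyz hvz hle with ⟨w, hw, h1, h2⟩ | ⟨y', hy', hk, w, hw, h1, h2⟩
    · exact ⟨y, w, hy, hlt, h1, h2, hw⟩
    · refine ⟨y', w, hy', ?_, h1, h2, hw⟩
      have := hmono hy' hvd hk
      rwa [Function.update_eq_self] at this

end RootedLabel

/-! ### Composition of decorated sets -/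

namespace SetOperad

/-- A finite set of labels decorated by an operation. -/
abbrev DecoratedSet (P : SetOperad.{u}) (n : ℕ) : Type u :=
  Σ B : Finset (Fin n), P.Op B.card

variable {P : SetOperad.{u}} {n : ℕ}

theorem DecoratedSet.nonempty (b : P.DecoratedSet n) : b.1.Nonempty := by
  obtain ⟨B, q⟩ := b
  rcases B.eq_empty_or_nonempty with rfl | h
  · exact (P.isEmpty_zero.false q).elim
  · exact h

/-- The decorated set `b` is composed of the decorated sets `ds i` by means of `p`. -/
def IsComp {k : ℕ} (p : P.Op k) (ds : Fin k → P.DecoratedSet n) (b : P.DecoratedSet n) : Prop :=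
  ∃ e : (Σ i, Fin (ds i).1.card) ≃ Fin b.1.card,
    (∀ i x, b.1.orderEmbOfFin rfl (e ⟨i, x⟩) = (ds i).1.orderEmbOfFin rfl x) ∧
    b.2 = P.comp (fun i => (ds i).1.card) e p (fun i => (ds i).2)

theorem exists_orderEmbOfFin_eq {B : Finset (Fin n)} {a : Fin n} (h : a ∈ B) :
    ∃ x, B.orderEmbOfFin rfl x = a := by
  rw [← Finset.mem_coe, ← Finset.range_orderEmbOfFin B rfl] at h
  exact h

namespace IsComp

variable {k : ℕ} {p : P.Op k} {ds : Fin k → P.DecoratedSet n} {b b' : P.DecoratedSet n}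

theorem mem_iff (h : IsComp p ds b) (a : Fin n) : a ∈ b.1 ↔ ∃ i, a ∈ (ds i).1 := by
  obtain ⟨e, he, -⟩ := h
  constructor
  · intro ha
    obtain ⟨x, rfl⟩ := exists_orderEmbOfFin_eq ha
    obtain ⟨⟨i, y⟩, rfl⟩ := e.surjective x
    exact ⟨i, by rw [he]; exact orderEmbOfFin_mem _ _ _⟩
  · rintro ⟨i, ha⟩
    obtain ⟨x, rfl⟩ := exists_orderEmbOfFin_eq ha
    rw [← he]
    exact orderEmbOfFin_mem _ _ _

theorem subset (h : IsComp p ds b) (i : Fin k) : (ds i).1 ⊆ b.1 :=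
  fun _ ha => (h.mem_iff _).2 ⟨i, ha⟩

theorem eq_of_mem (h : IsComp p ds b) {i j : Fin k} {a : Fin n} (hi : a ∈ (ds i).1)
    (hj : a ∈ (ds j).1) : i = j := by
  obtain ⟨e, he, -⟩ := h
  obtain ⟨x, rfl⟩ := exists_orderEmbOfFin_eq hi
  obtain ⟨y, hy⟩ := exists_orderEmbOfFin_eq hj
  rw [← he, ← he] at hy
  exact (congrArg Sigma.fst (e.injective ((b.1.orderEmbOfFin rfl).injective hy))).symm

/-- The underlying set is the union of the parts, and the matching of inputs is forced because the
ascending enumeration is injective. -/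
theorem unique (h : IsComp p ds b) (h' : IsComp p ds b') : b = b' := by
  have hb : b.1 = b'.1 := Finset.ext fun a => (h.mem_iff a).trans (h'.mem_iff a).symm
  obtain ⟨B, q⟩ := b
  obtain ⟨B', q'⟩ := b'
  obtain rfl : B = B' := hb
  obtain ⟨e, he, hq⟩ := h
  obtain ⟨e', he', hq'⟩ := h'
  obtain rfl : e = e' := by
    ext ⟨i, x⟩ : 1
    exact (B.orderEmbOfFin rfl).injective ((he i x).trans (he' i x).symm)
  exact congrArg (Sigma.mk B) (hq.trans hq'.symm)

theorem exists_of_disjoint {k : ℕ} (p : P.Op k) (ds : Fin k → P.DecoratedSet n)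
    (h : ∀ i j a, a ∈ (ds i).1 → a ∈ (ds j).1 → i = j) : ∃ b, IsComp p ds b := by
  let B : Finset (Fin n) := univ.biUnion fun i => (ds i).1
  have hB : ∀ i x, (ds i).1.orderEmbOfFin rfl x ∈ B := fun i x =>
    mem_biUnion.2 ⟨i, mem_univ _, orderEmbOfFin_mem _ _ _⟩
  let g : (Σ i, Fin (ds i).1.card) → Fin B.card := fun x =>
    (B.orderIsoOfFin rfl).symm ⟨_, hB x.1 x.2⟩
  have hg : ∀ i x, B.orderEmbOfFin rfl (g ⟨i, x⟩) = (ds i).1.orderEmbOfFin rfl x := fun i x => by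
    rw [← coe_orderIsoOfFin_apply, OrderIso.apply_symm_apply]
  have hbij : Function.Bijective g := by
    constructor
    · rintro ⟨i, x⟩ ⟨j, y⟩ hxy
      have h1 := hg i x
      rw [hxy, hg] at h1
      obtain rfl := h i j _ (orderEmbOfFin_mem _ rfl x) (h1 ▸ orderEmbOfFin_mem _ rfl y)
      rw [((ds i).1.orderEmbOfFin rfl).injective h1]
    · intro y
      obtain ⟨i, -, hi⟩ := mem_biUnion.1 (orderEmbOfFin_mem B rfl y)
      obtain ⟨x, hx⟩ := exists_orderEmbOfFin_eq hi
      exact ⟨⟨i, x⟩, (B.orderEmbOfFin rfl).injective ((hg i x).trans hx)⟩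
  exact ⟨⟨B, P.comp _ (Equiv.ofBijective g hbij) p fun i => (ds i).2⟩,
    Equiv.ofBijective g hbij, hg, rfl⟩

theorem relabel {ds : Fin k → P.DecoratedSet n} (τ : Equiv.Perm (Fin k))
    (h : IsComp p (fun i => ds (τ i)) b) : IsComp (P.relabel τ p) ds b := by
  obtain ⟨e, he, hb⟩ := h
  let c := Equiv.sigmaCongrLeft (β := fun i => Fin (ds i).1.card) τ
  refine ⟨c.symm.trans e, fun i x => ?_, ?_⟩
  · obtain ⟨⟨j, y⟩, hy⟩ := c.surjective ⟨i, x⟩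
    rw [← hy, Equiv.trans_apply, Equiv.symm_apply_apply, he]
    obtain ⟨rfl, h2⟩ := Sigma.mk.inj_iff.1 hy
    obtain rfl := eq_of_heq h2
    rfl
  · rw [P.comp_relabel_left, hb]
    congr 1
    ext x : 1
    simp only [Equiv.trans_apply]
    exact congrArg e (c.symm_apply_apply x).symm

theorem swap {c : P.Op 2} {b₁ b₂ : P.DecoratedSet n} (h : IsComp c ![b₁, b₂] b) :
    ∃ c', IsComp (P := P) c' ![b₂, b₁] b := by
  refine ⟨P.relabel (Equiv.swap 0 1) c, relabel _ ?_⟩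
  convert h using 1
  funext i
  fin_cases i <;> simp

theorem one (b : P.DecoratedSet n) : IsComp P.one (fun _ => b) b :=
  ⟨Equiv.uniqueSigma fun _ : Fin 1 => Fin b.1.card, fun i x => by
    obtain rfl := Subsingleton.elim i 0
    rfl, (P.one_comp _).symm⟩

theorem assoc {K : ℕ} {l : Fin k → ℕ} {f : (Σ i, Fin (l i)) ≃ Fin K} {ds : Fin K → P.DecoratedSet n}
    {bs : Fin k → P.DecoratedSet n} {q : (i : Fin k) → P.Op (l i)}
    (hq : ∀ i, IsComp (q i) (fun j => ds (f ⟨i, j⟩)) (bs i)) (h : IsComp p bs b) :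
    IsComp (P.comp l f p q) ds b := by
  obtain ⟨e₂, he₂, hb⟩ := h
  choose e₁ he₁ hbs using hq
  let e : (Σ x, Fin (ds x).1.card) ≃ Fin b.1.card :=
    (Equiv.sigmaCongrLeft (β := fun x => Fin (ds x).1.card) f).symm.trans
      ((Equiv.sigmaAssoc fun i j => Fin (ds (f ⟨i, j⟩)).1.card).trans
        ((Equiv.sigmaCongrRight e₁).trans e₂))
  have he : ∀ i j x, e ⟨f ⟨i, j⟩, x⟩ = e₂ ⟨i, e₁ i ⟨j, x⟩⟩ := by
    intro i j x
    have : (Equiv.sigmaCongrLeft (β := fun x => Fin (ds x).1.card) f).symm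
        ⟨f ⟨i, j⟩, x⟩ = ⟨⟨i, j⟩, x⟩ := by
      rw [Equiv.symm_apply_eq]
      rfl
    simp only [e, Equiv.trans_apply, this]
    rfl
  refine ⟨e, fun x y => ?_, ?_⟩
  · obtain ⟨⟨i, j⟩, rfl⟩ := f.surjective x
    rw [he, he₂, he₁]
  · rw [P.assoc l f _ e _ e₁ e₂ (fun i j x => (he i j x).symm), hb]
    congr 1
    exact funext hbs

/-- The intermediate composites exist by disjointness; recomposing them gives `b` by associativity
and uniqueness. -/
theorem of_comp {K : ℕ} {l : Fin k → ℕ} {f : (Σ i, Fin (l i)) ≃ Fin K}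
    {ds : Fin K → P.DecoratedSet n} {q : (i : Fin k) → P.Op (l i)}
    (h : IsComp (P.comp l f p q) ds b) :
    ∃ bs : Fin k → P.DecoratedSet n,
      (∀ i, IsComp (q i) (fun j => ds (f ⟨i, j⟩)) (bs i)) ∧ IsComp p bs b := by
  have hex : ∀ i, ∃ c, IsComp (q i) (fun j => ds (f ⟨i, j⟩)) c := fun i =>
    exists_of_disjoint _ _ fun j j' a hj hj' => by
      have := f.injective (h.eq_of_mem hj hj')
      simpa using this
  choose bs hbs using hex
  obtain ⟨b', hb'⟩ := exists_of_disjoint p bs fun i i' a hi hi' => by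
    obtain ⟨j, hj⟩ := ((hbs i).mem_iff a).1 hi
    obtain ⟨j', hj'⟩ := ((hbs i').mem_iff a).1 hi'
    exact congrArg Sigma.fst (f.injective (h.eq_of_mem hj hj'))
  obtain rfl := unique (assoc hbs hb') h
  exact ⟨bs, hbs, hb'⟩

theorem mem_pair {c : P.Op 2} {b₁ b₂ : P.DecoratedSet n} (h : IsComp c ![b₁, b₂] b) (a : Fin n) :
    a ∈ b.1 ↔ a ∈ b₁.1 ∨ a ∈ b₂.1 := by
  rw [h.mem_iff]
  exact Fin.exists_fin_two

theorem disjoint_pair {c : P.Op 2} {b₁ b₂ : P.DecoratedSet n} (h : IsComp c ![b₁, b₂] b) :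
    Disjoint b₁.1 b₂.1 :=
  Finset.disjoint_left.2 fun _ h1 h2 =>
    absurd (h.eq_of_mem (i := 0) (j := 1) h1 h2) (by decide)

/-- The rotation of trees: the identity in `P 3` is evaluated on the three decorated sets, and the
other bracketing is read off with `of_comp`. -/
theorem weakAssoc (hP : P.IsWeaklyAssociative) {c d : P.Op 2} {b₁ b₂ b₃ b₁₂ : P.DecoratedSet n}
    (h : IsComp c ![b₁₂, b₃] b) (h' : IsComp d ![b₁, b₂] b₁₂) :
    ∃ c' d' b₂₃, IsComp (P := P) d' ![b₂, b₃] b₂₃ ∧ IsComp (P := P) c' ![b₁, b₂₃] b := by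
  obtain ⟨k, l, hkl⟩ := hP d c
  have h1 : IsComp (P.comp₂ c d P.one (finSumFinEquiv : Fin 2 ⊕ Fin 1 ≃ Fin 3))
      ![b₁, b₂, b₃] b := by
    refine assoc (bs := ![b₁₂, b₃]) (Fin.forall_fin_two.2 ⟨?_, ?_⟩) h
    · show IsComp d (fun j : Fin 2 => _) b₁₂
      convert h' using 1
      funext j
      fin_cases j <;> rfl
    · show IsComp P.one (fun j : Fin 1 => _) b₃
      convert one b₃ using 1
      funext j
      fin_cases j
      rfl
  rw [hkl] at h1
  obtain ⟨bs, hbs, hb⟩ := of_comp h1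
  have h2 : IsComp P.one (fun j : Fin 1 => _) (bs 0) := hbs 0
  have h3 : IsComp k (fun j : Fin 2 => _) (bs 1) := hbs 1
  have h4 : bs 0 = b₁ := by
    refine h2.unique ?_
    convert one b₁ using 1
    funext j
    fin_cases j
    rfl
  refine ⟨l, k, bs 1, ?_, ?_⟩
  · convert h3 using 1
    funext j
    fin_cases j <;> rfl
  · convert hb using 1
    funext j
    fin_cases j
    · exact h4.symm
    · rfl

end IsComp

/-! ### Trees with decorated leaves -/

/-- The values of binary trees whose vertices are decorated by binary operations and whose leaves
are decorated by elements of `S`. -/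
inductive IsTree (S : Set (P.DecoratedSet n)) : P.DecoratedSet n → Prop
  | leaf {b : P.DecoratedSet n} (hb : b ∈ S) : IsTree S b
  | node {c : P.Op 2} {b₁ b₂ b : P.DecoratedSet n} (h₁ : IsTree S b₁) (h₂ : IsTree S b₂)
      (h : IsComp c ![b₁, b₂] b) : IsTree S b

theorem IsTreeValue.isTree {k : ℕ} {p : P.Op k} (hp : P.IsTreeValue p)
    {S : Set (P.DecoratedSet n)} {ds : Fin k → P.DecoratedSet n} {b : P.DecoratedSet n}
    (h : IsComp p ds b) (hS : ∀ i, ds i ∈ S) : IsTree S b := by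
  induction hp generalizing b with
  | leaf =>
    obtain rfl : ds 0 = b := by
      refine IsComp.unique ?_ h
      convert IsComp.one (ds 0) using 1
      funext j
      fin_cases j
      rfl
    exact .leaf (hS 0)
  | node c p q σ hp hq ihp ihq =>
    obtain ⟨bs, hbs, hb⟩ := h.of_comp
    refine .node (ihp (hbs 0) fun i => hS _) (ihq (hbs 1) fun i => hS _) (c := c) ?_
    convert hb using 1
    funext j
    fin_cases j <;> rfl

namespace IsTree

variable {S S' : Set (P.DecoratedSet n)} {b : P.DecoratedSet n}

theorem exists_isComp (h : IsTree S b) :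
    ∃ (k : ℕ) (p : P.Op k) (ds : Fin k → P.DecoratedSet n), IsComp p ds b ∧ ∀ i, ds i ∈ S := by
  induction h with
  | @leaf b hb => exact ⟨1, P.one, fun _ => b, IsComp.one b, fun _ => hb⟩
  | @node c b₁ b₂ b h₁ h₂ h ih₁ ih₂ =>
    have hex : ∀ i, ∃ (k : ℕ) (p : P.Op k) (ds : Fin k → P.DecoratedSet n),
        IsComp p ds (![b₁, b₂] i) ∧ ∀ i, ds i ∈ S := Fin.forall_fin_two.2 ⟨ih₁, ih₂⟩
    choose l q ds hds hS using hex
    let f : (Σ i : Fin 2, Fin (l i)) ≃ Fin (∑ i, l i) := finSigmaFinEquiv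
    refine ⟨_, P.comp l f c q, fun x => ds (f.symm x).1 (f.symm x).2,
      IsComp.assoc (fun i => ?_) h, fun x => hS _ _⟩
    convert hds i using 1
    funext j
    have : f.symm (f ⟨i, j⟩) = ⟨i, j⟩ := f.symm_apply_apply _
    rw [this]

theorem subset_of_mem (h : IsTree S b) (hS : ∀ s ∈ S, ∀ s' ∈ S, ∀ a, a ∈ s.1 → a ∈ s'.1 → s = s')
    {s : P.DecoratedSet n} (hs : s ∈ S) {a : Fin n} (ha : a ∈ s.1) (hab : a ∈ b.1) : s.1 ⊆ b.1 := by
  induction h with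
  | leaf hb =>
    rw [hS s hs _ hb a ha hab]
  | node h₁ h₂ h ih₁ ih₂ =>
    rcases (h.mem_pair a).1 hab with h' | h'
    · exact (ih₁ h').trans (h.subset 0)
    · exact (ih₂ h').trans (h.subset 1)

theorem mono (h : IsTree S b) (hS : ∀ s ∈ S, s.1 ⊆ b.1 → s ∈ S') : IsTree S' b := by
  induction h with
  | leaf hb => exact .leaf (hS _ hb subset_rfl)
  | node h₁ h₂ h ih₁ ih₂ =>
    exact .node (ih₁ fun s hs hsb => hS s hs (hsb.trans (h.subset 0)))
      (ih₂ fun s hs hsb => hS s hs (hsb.trans (h.subset 1))) h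

/-- In a weakly associative operad any two leaves of a tree can be made adjacent. -/
theorem exists_adjacent (hP : P.IsWeaklyAssociative)
    (hS : ∀ s ∈ S, ∀ s' ∈ S, ∀ a, a ∈ s.1 → a ∈ s'.1 → s = s') (h : IsTree S b)
    {s t : P.DecoratedSet n} (hs : s ∈ S) (ht : t ∈ S) (hst : s ≠ t) (hsb : s.1 ⊆ b.1)
    (htb : t.1 ⊆ b.1) :
    ∃ c m, IsComp (P := P) c ![s, t] m ∧
      ∀ S' : Set (P.DecoratedSet n), m ∈ S' → (∀ r ∈ S, r ≠ s → r ≠ t → r ∈ S') → IsTree S' b := by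
  -- Induction on the size of the underlying set, since rotations change the tree but shrink the
  -- part that contains both leaves. Quantifying over `S'` says that `s` and `t` have been replaced
  -- by the single leaf `m`.
  induction hN : b.1.card using Nat.strong_induction_on generalizing b s t with
  | _ N ih =>
  subst hN
  have hdisj : ∀ {c : P.Op 2} {b₁ b₂ b₀ s : P.DecoratedSet n}, IsComp c ![b₁, b₂] b₀ → s.1 ⊆ b₁.1 →
      s.1 ⊆ b₂.1 → False := by
    intro c b₁ b₂ b₀ s h h1 h2
    obtain ⟨a, ha⟩ := s.nonempty
    exact Finset.disjoint_left.1 h.disjoint_pair (h1 ha) (h2 ha)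
  have hcard : ∀ {c : P.Op 2} {b₁ b₂ b₀ : P.DecoratedSet n}, IsComp c ![b₁, b₂] b₀ →
      b₁.1.card < b₀.1.card ∧ b₂.1.card < b₀.1.card := by
    intro c b₁ b₂ b₀ h
    refine ⟨card_lt_card ⟨h.subset 0, fun h' => ?_⟩, card_lt_card ⟨h.subset 1, fun h' => ?_⟩⟩
    · exact hdisj h ((h.subset 1).trans h') subset_rfl
    · exact hdisj h subset_rfl ((h.subset 0).trans h')
  have hcases : ∀ {c : P.Op 2} {b₁ b₂ b₀ s : P.DecoratedSet n}, IsTree S b₁ → IsTree S b₂ →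
      IsComp c ![b₁, b₂] b₀ → s ∈ S → s.1 ⊆ b₀.1 → s.1 ⊆ b₁.1 ∨ s.1 ⊆ b₂.1 := by
    intro c b₁ b₂ b₀ s h₁ h₂ h hs hsb
    obtain ⟨a, ha⟩ := s.nonempty
    rcases (h.mem_pair a).1 (hsb ha) with h' | h'
    · exact .inl (h₁.subset_of_mem hS hs ha h')
    · exact .inr (h₂.subset_of_mem hS hs ha h')
  have hcomm : ∀ {s t : P.DecoratedSet n}, (∃ c m, IsComp (P := P) c ![s, t] m ∧
      ∀ S' : Set (P.DecoratedSet n), m ∈ S' → (∀ r ∈ S, r ≠ s → r ≠ t → r ∈ S') → IsTree S' b) →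
      ∃ c m, IsComp (P := P) c ![t, s] m ∧
      ∀ S' : Set (P.DecoratedSet n), m ∈ S' → (∀ r ∈ S, r ≠ t → r ≠ s → r ∈ S') →
        IsTree S' b := by
    rintro s t ⟨c, m, hm, h⟩
    obtain ⟨c', hc'⟩ := hm.swap
    exact ⟨c', m, hc', fun S' h1 h2 => h S' h1 fun r hr hr1 hr2 => h2 r hr hr2 hr1⟩
  -- Both leaves lie in one branch: the induction hypothesis applies there, and the other branch
  -- contains neither leaf.
  have hsame : ∀ {s t : P.DecoratedSet n} {c : P.Op 2} {b₁ b₂ : P.DecoratedSet n}, s ∈ S → t ∈ S →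
      s ≠ t → IsTree S b₁ → IsTree S b₂ → IsComp c ![b₁, b₂] b → s.1 ⊆ b₂.1 → t.1 ⊆ b₂.1 →
      ∃ c m, IsComp (P := P) c ![s, t] m ∧
      ∀ S' : Set (P.DecoratedSet n), m ∈ S' → (∀ r ∈ S, r ≠ s → r ≠ t → r ∈ S') →
        IsTree S' b := by
    intro s t c b₁ b₂ hs ht hst h₁ h₂ h hsb htb
    obtain ⟨d, m, hm, hS'⟩ := ih _ (hcard h).2 h₂ hs ht hst hsb htb rfl
    refine ⟨d, m, hm, fun S' h1 h2 => .node (h₁.mono fun r hr hrb => h2 r hr ?_ ?_)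
      (hS' S' h1 h2) h⟩
    · rintro rfl
      exact hdisj h hrb hsb
    · rintro rfl
      exact hdisj h hrb htb
  -- The leaves lie in different branches and that of `s` splits as `(x, y)`, with `s` in `y` after
  -- a swap. Rotating `((x, y), b₂)` to `(x, (y, b₂))` puts both leaves into one branch.
  have hrot : ∀ {s t : P.DecoratedSet n} {c d : P.Op 2} {x y b₁ b₂ : P.DecoratedSet n}, s ∈ S →
      t ∈ S → s ≠ t → IsTree S x → IsTree S y → IsComp d ![x, y] b₁ → IsTree S b₂ →
      IsComp c ![b₁, b₂] b → s.1 ⊆ b₁.1 → t.1 ⊆ b₂.1 →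
      ∃ c m, IsComp (P := P) c ![s, t] m ∧
      ∀ S' : Set (P.DecoratedSet n), m ∈ S' → (∀ r ∈ S, r ≠ s → r ≠ t → r ∈ S') →
        IsTree S' b := by
    intro s t c d x y b₁ b₂ hs ht hst hx hy hxy h₂ h hsb htb
    wlog hsy : s.1 ⊆ y.1 generalizing x y d
    · obtain ⟨d', hd'⟩ := hxy.swap
      exact this hy hx hd' ((hcases hx hy hxy hs hsb).resolve_right hsy)
    obtain ⟨c', d', z, hz, hc'⟩ := h.weakAssoc hP hxy
    exact hsame hs ht hst hx (.node hy h₂ hz) hc' (hsy.trans (hz.subset 0))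
      (htb.trans (hz.subset 1))
  have hdiff : ∀ {s t : P.DecoratedSet n} {c : P.Op 2} {b₁ b₂ : P.DecoratedSet n}, s ∈ S → t ∈ S →
      s ≠ t → IsTree S b₁ → IsTree S b₂ → IsComp c ![b₁, b₂] b → s.1 ⊆ b₁.1 → t.1 ⊆ b₂.1 →
      ∃ c m, IsComp (P := P) c ![s, t] m ∧
      ∀ S' : Set (P.DecoratedSet n), m ∈ S' → (∀ r ∈ S, r ≠ s → r ≠ t → r ∈ S') →
        IsTree S' b := by
    intro s t c b₁ b₂ hs ht hst h₁ h₂ h hsb htb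
    cases h₁ with
    | node hx hy hxy => exact hrot hs ht hst hx hy hxy h₂ h hsb htb
    | leaf h₁ =>
      cases h₂ with
      | node hx hy hxy =>
        obtain ⟨c', hc'⟩ := h.swap
        exact hcomm (hrot ht hs hst.symm hx hy hxy (.leaf h₁) hc' htb hsb)
      | leaf h₂ =>
        obtain ⟨a, ha⟩ := s.nonempty
        obtain rfl := hS _ hs _ h₁ a ha (hsb ha)
        obtain ⟨a, ha⟩ := t.nonempty
        obtain rfl := hS _ ht _ h₂ a ha (htb ha)
        exact ⟨c, b, h, fun S' h1 _ => .leaf h1⟩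
  cases h with
  | leaf hb =>
    obtain ⟨a, ha⟩ := s.nonempty
    obtain rfl := hS _ hs _ hb a ha (hsb ha)
    obtain ⟨a, ha⟩ := t.nonempty
    exact absurd (hS _ ht _ hb a ha (htb ha)).symm hst
  | node h₁ h₂ h =>
    obtain ⟨c', hc'⟩ := h.swap
    rcases hcases h₁ h₂ h hs hsb with h3 | h3 <;> rcases hcases h₁ h₂ h ht htb with h4 | h4
    · exact hsame hs ht hst h₂ h₁ hc' h3 h4
    · exact hdiff hs ht hst h₁ h₂ h h3 h4
    · exact hdiff hs ht hst h₂ h₁ hc' h3 h4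
    · exact hsame hs ht hst h₁ h₂ h h3 h4

end IsTree

end SetOperad

/-! ### Merging two blocks of a partition -/

namespace Finpartition

variable {n : ℕ}

theorem eq_of_parts_subset {π ρ : Finpartition (univ : Finset (Fin n))}
    (h : π.parts ⊆ ρ.parts) : π = ρ := by
  refine Finpartition.ext (Subset.antisymm h fun D hD => ?_)
  obtain ⟨d, hd⟩ := ρ.nonempty_of_mem_parts hD
  obtain ⟨A, hA, hdA⟩ := π.exists_mem (mem_univ d)
  rwa [← ρ.eq_of_mem_parts (h hA) hD hdA hd]

theorem subset_of_le {π ρ : Finpartition (univ : Finset (Fin n))} (h : π ≤ ρ)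
    {A D : Finset (Fin n)} (hA : A ∈ π.parts) (hD : D ∈ ρ.parts) {a : Fin n} (ha : a ∈ A)
    (haD : a ∈ D) : A ⊆ D := by
  obtain ⟨D', hD', hAD⟩ := h hA
  rwa [← ρ.eq_of_mem_parts hD' hD (hAD ha) haD]

theorem exists_two_blocks {π ρ : Finpartition (univ : Finset (Fin n))} (h : π ≤ ρ)
    {D : Finset (Fin n)} (hD : D ∈ ρ.parts) (hD' : D ∉ π.parts) {a : Fin n} (ha : a ∈ D) :
    ∃ A ∈ π.parts, ∃ B ∈ π.parts, A ≠ B ∧ A ⊆ D ∧ B ⊆ D ∧ a ∈ A := by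
  obtain ⟨A, hA, haA⟩ := π.exists_mem (mem_univ a)
  have hAD := subset_of_le h hA hD haA ha
  obtain ⟨b, hb, hbA⟩ : ∃ b ∈ D, b ∉ A := by
    by_contra! hall
    exact hD' (Subset.antisymm hAD hall ▸ hA)
  obtain ⟨B, hB, hbB⟩ := π.exists_mem (mem_univ b)
  exact ⟨A, hA, B, hB, fun hAB => hbA (hAB ▸ hbB), hAD, subset_of_le h hB hD hbB hb, haA⟩

/-- The partition `ρ` arises from `π` by merging the blocks `A` and `B`. -/
structure IsMerge (π ρ : Finpartition (univ : Finset (Fin n))) (A B : Finset (Fin n)) : Prop where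
  left_mem : A ∈ π.parts
  right_mem : B ∈ π.parts
  ne : A ≠ B
  parts_eq : ρ.parts = insert (A ∪ B) ((π.parts.erase A).erase B)

theorem union_notMem {π : Finpartition (univ : Finset (Fin n))} {A B : Finset (Fin n)}
    (hA : A ∈ π.parts) (hB : B ∈ π.parts) (hne : A ≠ B) : A ∪ B ∉ π.parts := by
  intro h
  obtain ⟨a, ha⟩ := π.nonempty_of_mem_parts hA
  obtain ⟨b, hb⟩ := π.nonempty_of_mem_parts hB
  exact hne ((π.eq_of_mem_parts hA h ha (mem_union_left _ ha)).trans
    (π.eq_of_mem_parts hB h hb (mem_union_right _ hb)).symm)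

theorem exists_isMerge {π : Finpartition (univ : Finset (Fin n))} {A B : Finset (Fin n)}
    (hA : A ∈ π.parts) (hB : B ∈ π.parts) (hne : A ≠ B) : ∃ ρ, IsMerge π ρ A B := by
  refine ⟨Finpartition.ofExistsUnique (insert (A ∪ B) ((π.parts.erase A).erase B))
    (fun _ _ => subset_univ _) (fun a _ => ?_) ?_, hA, hB, hne, rfl⟩
  · obtain ⟨C, hC, haC⟩ := π.exists_mem (mem_univ a)
    simp only [mem_insert, mem_erase]
    by_cases hCAB : C = A ∨ C = B
    · have haAB : a ∈ A ∪ B := by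
        rcases hCAB with rfl | rfl
        · exact mem_union_left _ haC
        · exact mem_union_right _ haC
      refine ⟨A ∪ B, ⟨.inl rfl, haAB⟩, ?_⟩
      rintro D ⟨rfl | ⟨h1, h2, h3⟩, haD⟩
      · rfl
      · obtain rfl := π.eq_of_mem_parts hC h3 haC haD
        tauto
    · push Not at hCAB
      refine ⟨C, ⟨.inr ⟨hCAB.2, hCAB.1, hC⟩, haC⟩, ?_⟩
      rintro D ⟨rfl | ⟨h1, h2, h3⟩, haD⟩
      · rcases mem_union.1 haD with h | h
        · exact absurd (π.eq_of_mem_parts hC hA haC h) hCAB.1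
        · exact absurd (π.eq_of_mem_parts hC hB haC h) hCAB.2
      · exact π.eq_of_mem_parts h3 hC haD haC
  · simp only [mem_insert, mem_erase, not_or]
    refine ⟨fun h => ?_, fun h => π.empty_notMem_parts h.2.2⟩
    obtain ⟨a, ha⟩ := π.nonempty_of_mem_parts hA
    exact notMem_empty a (h ▸ mem_union_left _ ha)

namespace IsMerge

variable {π ρ ρ' : Finpartition (univ : Finset (Fin n))} {A B C : Finset (Fin n)}

theorem mem_iff (h : IsMerge π ρ A B) : C ∈ ρ.parts ↔ C = A ∪ B ∨ C ∈ π.parts ∧ C ≠ A ∧ C ≠ B := by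
  rw [h.parts_eq, mem_insert, mem_erase, mem_erase]
  tauto

theorem union_mem (h : IsMerge π ρ A B) : A ∪ B ∈ ρ.parts := h.mem_iff.2 (.inl rfl)

theorem union_notMem (h : IsMerge π ρ A B) : A ∪ B ∉ π.parts :=
  Finpartition.union_notMem h.left_mem h.right_mem h.ne

theorem mem_of_ne (h : IsMerge π ρ A B) (hC : C ∈ ρ.parts) (hne : C ≠ A ∪ B) : C ∈ π.parts :=
  ((h.mem_iff.1 hC).resolve_left hne).1

theorem card (h : IsMerge π ρ A B) : ρ.parts.card + 1 = π.parts.card := by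
  have h1 : A ∪ B ∉ (π.parts.erase A).erase B := fun h' =>
    h.union_notMem (mem_of_mem_erase (mem_of_mem_erase h'))
  have h2 := card_pos.2 ⟨_, mem_erase.2 ⟨h.ne.symm, h.right_mem⟩⟩
  rw [h.parts_eq, card_insert_of_notMem h1,
    card_erase_of_mem (mem_erase.2 ⟨h.ne.symm, h.right_mem⟩)]
  rw [card_erase_of_mem h.left_mem] at h2 ⊢
  omega

theorem le (h : IsMerge π ρ A B) : π ≤ ρ := by
  intro C hC
  by_cases hA : C = A
  · exact ⟨_, h.union_mem, hA ▸ subset_union_left⟩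
  by_cases hB : C = B
  · exact ⟨_, h.union_mem, hB ▸ subset_union_right⟩
  · exact ⟨C, h.mem_iff.2 (.inr ⟨hC, hA, hB⟩), le_rfl⟩

theorem eq_of_subset_of_mem (h : IsMerge π ρ A B) {D : Finset (Fin n)} (hD : D ∈ π.parts)
    (hAB : A ∪ B ⊆ D) : False := by
  obtain ⟨a, ha⟩ := π.nonempty_of_mem_parts h.left_mem
  obtain ⟨b, hb⟩ := π.nonempty_of_mem_parts h.right_mem
  exact h.ne ((π.eq_of_mem_parts h.left_mem hD ha (hAB (mem_union_left _ ha))).trans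
    (π.eq_of_mem_parts h.right_mem hD hb (hAB (mem_union_right _ hb))).symm)

/-- A block of `π` contained in the new block is one of the two blocks that were merged. -/
theorem eq_or_eq_of_subset (h : IsMerge π ρ A B) (hC : C ∈ π.parts) (hCM : C ⊆ A ∪ B) :
    C = A ∨ C = B := by
  obtain ⟨c, hc⟩ := π.nonempty_of_mem_parts hC
  rcases mem_union.1 (hCM hc) with h' | h'
  · exact .inl (π.eq_of_mem_parts hC h.left_mem hc h')
  · exact .inr (π.eq_of_mem_parts hC h.right_mem hc h')

/-- The set `A ∪ B` contains only two blocks of `π`, so `A'` and `B'` must be these. -/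
theorem union_eq_of_subset (h : IsMerge π ρ A B) {A' B' : Finset (Fin n)}
    (h' : IsMerge π ρ' A' B') (hs : A' ∪ B' ⊆ A ∪ B) : A' ∪ B' = A ∪ B := by
  have h1 := h.eq_or_eq_of_subset h'.left_mem (subset_union_left.trans hs)
  have h2 := h.eq_or_eq_of_subset h'.right_mem (subset_union_right.trans hs)
  have h3 := h'.ne
  rcases h1 with rfl | rfl <;> rcases h2 with rfl | rfl
  · exact absurd rfl h3
  · rfl
  · exact union_comm _ _
  · exact absurd rfl h3

theorem part_eq_of_union_eq (h : IsMerge π ρ A B) {A' B' : Finset (Fin n)}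
    (h' : IsMerge π ρ' A' B') (he : A' ∪ B' = A ∪ B) : ρ = ρ' := by
  refine eq_of_parts_subset fun C hC => ?_
  rcases h.mem_iff.1 hC with rfl | ⟨h1, h2, h3⟩
  · exact he ▸ h'.union_mem
  · refine h'.mem_iff.2 (.inr ⟨h1, ?_, ?_⟩)
    · rintro rfl
      rcases h.eq_or_eq_of_subset h'.left_mem (he ▸ subset_union_left) with h | h <;> tauto
    · rintro rfl
      rcases h.eq_or_eq_of_subset h'.right_mem (he ▸ subset_union_right) with h | h <;> tauto

end IsMerge

end Finpartition

/-! ### Merges and covers of `P`-partitions -/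

namespace SetOperad

namespace Partition

variable {P : SetOperad.{u}} {n : ℕ}

/-- The decorated blocks of a `P`-partition. -/
def blocks (X : P.Partition n) : Set (P.DecoratedSet n) :=
  Set.range fun B : X.part.parts => (⟨B, X.dec B⟩ : P.DecoratedSet n)

theorem mem_parts_of_mem_blocks {X : P.Partition n} {b : P.DecoratedSet n} (hb : b ∈ X.blocks) :
    b.1 ∈ X.part.parts := by
  obtain ⟨B, rfl⟩ := hb
  exact B.2

theorem exists_mem_blocks {X : P.Partition n} {B : Finset (Fin n)} (hB : B ∈ X.part.parts) :
    ∃ b ∈ X.blocks, b.1 = B :=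
  ⟨_, ⟨⟨B, hB⟩, rfl⟩, rfl⟩

theorem eq_of_mem_blocks {X : P.Partition n} {b b' : P.DecoratedSet n} (hb : b ∈ X.blocks)
    (hb' : b' ∈ X.blocks) {a : Fin n} (ha : a ∈ b.1) (ha' : a ∈ b'.1) : b = b' := by
  obtain ⟨B, rfl⟩ := hb
  obtain ⟨B', rfl⟩ := hb'
  obtain rfl : B = B' := Subtype.ext (X.part.eq_of_mem_parts B.2 B'.2 ha ha')
  rfl

theorem eq_of_blocks_subset {X Y : P.Partition n} (h : X.blocks ⊆ Y.blocks) : X = Y := by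
  have hp : X.part = Y.part := Finpartition.eq_of_parts_subset fun B hB => by
    obtain ⟨b, hb, rfl⟩ := exists_mem_blocks hB
    exact mem_parts_of_mem_blocks (h hb)
  obtain ⟨π, u⟩ := X
  obtain ⟨π', v⟩ := Y
  obtain rfl : π = π' := hp
  congr 1
  funext B
  obtain ⟨B', hB'⟩ := h ⟨B, rfl⟩
  obtain ⟨h1, h2⟩ := Sigma.mk.inj_iff.1 hB'
  obtain rfl : B' = B := Subtype.ext h1
  exact (eq_of_heq h2).symm

theorem isComposite_iff {X : P.Partition n} {b : P.DecoratedSet n} :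
    X.IsComposite b.1 b.2 ↔ ∃ (k : ℕ) (p : P.Op k) (ds : Fin k → P.DecoratedSet n),
      IsComp p ds b ∧ ∀ i, ds i ∈ X.blocks := by
  constructor
  · rintro ⟨t, a, -, -, p, e, he, hq⟩
    exact ⟨t, p, fun i => ⟨a i, X.dec (a i)⟩, ⟨e, he, hq⟩, fun i => ⟨a i, rfl⟩⟩
  · rintro ⟨k, p, ds, hds, hX⟩
    choose a ha using hX
    obtain rfl : (fun i => (⟨a i, X.dec (a i)⟩ : P.DecoratedSet n)) = ds := funext ha
    have hcomp := hds
    obtain ⟨e, he, hq⟩ := hds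
    refine ⟨k, a, fun i j hij => ?_, fun A => ⟨?_, fun hA => ?_⟩, p, e, he, hq⟩
    · obtain ⟨x, hx⟩ := X.part.nonempty_of_mem_parts (a i).2
      exact hcomp.eq_of_mem hx (hij ▸ hx)
    · rintro ⟨i, rfl⟩
      exact hcomp.subset i
    · obtain ⟨x, hx⟩ := X.part.nonempty_of_mem_parts A.2
      obtain ⟨i, hi⟩ := (hcomp.mem_iff x).1 (hA hx)
      exact ⟨i, Subtype.ext (X.part.eq_of_mem_parts (a i).2 A.2 hi hx)⟩

theorem le_iff {X Y : P.Partition n} : X ≤ Y ↔ X.part ≤ Y.part ∧ ∀ b ∈ Y.blocks,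
    ∃ (k : ℕ) (p : P.Op k) (ds : Fin k → P.DecoratedSet n),
      IsComp p ds b ∧ ∀ i, ds i ∈ X.blocks := by
  rw [le_def]
  refine and_congr_right fun _ => ⟨?_, fun h B => ?_⟩
  · rintro h b ⟨B, rfl⟩
    exact isComposite_iff.1 (h B)
  · exact isComposite_iff (b := ⟨B, Y.dec B⟩).2 (h _ ⟨B, rfl⟩)

theorem le_iff_isTree (hgen : ∀ {k : ℕ} (p : P.Op k), P.IsTreeValue p) {X Y : P.Partition n} :
    X ≤ Y ↔ X.part ≤ Y.part ∧ ∀ b ∈ Y.blocks, IsTree X.blocks b := by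
  rw [le_iff]
  refine and_congr_right fun _ => forall₂_congr fun b _ => ⟨?_, IsTree.exists_isComp⟩
  rintro ⟨k, p, ds, h, hX⟩
  exact (hgen p).isTree h hX

/-- An unchanged block is composed of one block by a unary operation, which can only be the
identity. -/
theorem eq_of_le_of_mem_blocks [P.IsReduced] {X Y : P.Partition n} (h : X ≤ Y)
    {b b' : P.DecoratedSet n} (hb : b ∈ X.blocks) (hb' : b' ∈ Y.blocks) (he : b.1 = b'.1) :
    b = b' := by
  obtain ⟨k, p, ds, hds, hX⟩ := (le_iff.1 h).2 b' hb'
  have hdsb : ∀ i, ds i = b := fun i => by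
    obtain ⟨a, ha⟩ := (ds i).nonempty
    exact eq_of_mem_blocks (hX i) hb ha (he ▸ hds.subset i ha)
  obtain rfl : ds = fun _ => b := funext hdsb
  obtain ⟨a, ha⟩ := b.nonempty
  obtain ⟨i₀, -⟩ := (hds.mem_iff a).1 (he ▸ ha)
  obtain rfl : k = 1 := by
    have h1 : Fintype.card (Fin k) ≤ 1 :=
      Fintype.card_le_one_iff.2 fun i j => hds.eq_of_mem (i := i) (j := j) ha ha
    have h2 := i₀.2
    simp only [Fintype.card_fin] at h1
    omega
  obtain rfl := IsReduced.eq_one p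
  exact (IsComp.one b).unique hds

theorem eq_of_le_of_part_eq [P.IsReduced] {X Y : P.Partition n} (h : X ≤ Y)
    (hp : X.part = Y.part) : X = Y := by
  refine (eq_of_blocks_subset fun b hb => ?_)
  obtain ⟨b', hb', he⟩ := exists_mem_blocks (hp ▸ mem_parts_of_mem_blocks hb)
  exact eq_of_le_of_mem_blocks h hb hb' he.symm ▸ hb'

/-- Two blocks of `X` in the same block of `Z ≥ X` can be merged below `Z`. -/
theorem exists_merge (hgen : ∀ {k : ℕ} (p : P.Op k), P.IsTreeValue p)
    (hP : P.IsWeaklyAssociative) {X Z : P.Partition n} (h : X ≤ Z) {A B D : Finset (Fin n)}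
    (hA : A ∈ X.part.parts) (hB : B ∈ X.part.parts) (hAB : A ≠ B) (hD : D ∈ Z.part.parts)
    (hAD : A ⊆ D) (hBD : B ⊆ D) : ∃ Y, X ≤ Y ∧ Y ≤ Z ∧ X.part.IsMerge Y.part A B := by
  rw [le_iff_isTree hgen] at h
  obtain ⟨s, hs, rfl⟩ := exists_mem_blocks hA
  obtain ⟨t, ht, rfl⟩ := exists_mem_blocks hB
  obtain ⟨d, hd, rfl⟩ := exists_mem_blocks hD
  have hst : s ≠ t := fun h => hAB (congrArg Sigma.fst h)
  obtain ⟨c, m, hm, htree⟩ := (h.2 d hd).exists_adjacent hP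
    (fun s hs s' hs' a ha ha' => eq_of_mem_blocks hs hs' ha ha') hs ht hst hAD hBD
  have hm1 : m.1 = s.1 ∪ t.1 := Finset.ext fun a => by rw [hm.mem_pair, mem_union]
  obtain ⟨π, hπ⟩ := Finpartition.exists_isMerge hA hB hAB
  -- The new block carries the operation of `m`; all others keep their decoration from `X`.
  have hdec : ∀ C : π.parts, ∃ q : P.Op (C : Finset (Fin n)).card,
      (⟨C, q⟩ : P.DecoratedSet n) = m ∨ (⟨C, q⟩ : P.DecoratedSet n) ∈ X.blocks := by
    rintro ⟨C, hC⟩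
    rcases hπ.mem_iff.1 hC with hC' | ⟨hC', -, -⟩
    · obtain ⟨M, q⟩ := m
      obtain rfl : C = M := hC'.trans hm1.symm
      exact ⟨q, .inl rfl⟩
    · exact ⟨X.dec ⟨C, hC'⟩, .inr ⟨⟨C, hC'⟩, rfl⟩⟩
  choose dec hdec using hdec
  let Y : P.Partition n := ⟨π, dec⟩
  have hY : ∀ b ∈ Y.blocks, b = m ∨ b ∈ X.blocks := by
    rintro b ⟨C, rfl⟩
    exact hdec C
  have hmX : ∀ b ∈ X.blocks, b.1 ≠ m.1 := fun b hb he =>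
    hπ.union_notMem (hm1 ▸ he ▸ mem_parts_of_mem_blocks hb)
  have hmY : m ∈ Y.blocks := by
    obtain ⟨b, hb, he⟩ := exists_mem_blocks (X := Y) (hm1 ▸ hπ.union_mem : m.1 ∈ π.parts)
    rcases hY b hb with rfl | hb'
    · exact hb
    · exact absurd he (hmX b hb')
  have hXY : ∀ r ∈ X.blocks, r ≠ s → r ≠ t → r ∈ Y.blocks := by
    intro r hr hrs hrt
    have hne : ∀ s' ∈ X.blocks, r ≠ s' → r.1 ≠ s'.1 := fun s' hs' hne he => by
      obtain ⟨a, ha⟩ := r.nonempty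
      exact hne (eq_of_mem_blocks hr hs' ha (he ▸ ha))
    have hr' : r.1 ∈ π.parts :=
      hπ.mem_iff.2 (.inr ⟨mem_parts_of_mem_blocks hr, hne s hs hrs, hne t ht hrt⟩)
    obtain ⟨b, hb, he⟩ := exists_mem_blocks (X := Y) hr'
    rcases hY b hb with rfl | hb'
    · exact absurd he.symm (hmX r hr)
    · obtain ⟨a, ha⟩ := r.nonempty
      rwa [eq_of_mem_blocks hr hb' ha (he ▸ ha)]
  have hYD : ∀ {a}, a ∈ s.1 ∪ t.1 → a ∈ d.1 := fun ha => union_subset hAD hBD ha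
  refine ⟨Y, (le_iff_isTree hgen).2 ⟨hπ.le, fun b hb => ?_⟩, (le_iff_isTree hgen).2
    ⟨fun C hC => ?_, fun b hb => ?_⟩, hπ⟩
  · rcases hY b hb with rfl | hb'
    · exact .node (.leaf hs) (.leaf ht) hm
    · exact .leaf hb'
  · rcases hπ.mem_iff.1 hC with rfl | ⟨hC', -, -⟩
    · exact ⟨d.1, hD, union_subset hAD hBD⟩
    · exact h.1 hC'
  -- Only the tree of `d` has `s` and `t` among its leaves; the trees of the other blocks of `Z`
  -- remain valid.
  · by_cases hbd : b = d
    · subst hbd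
      exact htree _ hmY hXY
    · refine (h.2 b hb).mono fun r hr hrb => hXY r hr ?_ ?_
      · rintro rfl
        obtain ⟨a, ha⟩ := r.nonempty
        exact hbd (eq_of_mem_blocks hb hd (hrb ha) (hAD ha))
      · rintro rfl
        obtain ⟨a, ha⟩ := r.nonempty
        exact hbd (eq_of_mem_blocks hb hd (hrb ha) (hBD ha))

section Covers

variable [P.IsReduced]

theorem exists_merge_of_lt (hgen : ∀ {k : ℕ} (p : P.Op k), P.IsTreeValue p)
    (hP : P.IsWeaklyAssociative) {X Z : P.Partition n} (h : X < Z) :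
    ∃ Y A B, X ≤ Y ∧ Y ≤ Z ∧ X.part.IsMerge Y.part A B := by
  obtain ⟨D, hD, hDX⟩ : ∃ D ∈ Z.part.parts, D ∉ X.part.parts := by
    by_contra! hall
    exact h.ne (eq_of_le_of_part_eq h.le (Finpartition.eq_of_parts_subset hall).symm)
  obtain ⟨a, ha⟩ := Z.part.nonempty_of_mem_parts hD
  obtain ⟨A, hA, B, hB, hAB, hAD, hBD, -⟩ := Finpartition.exists_two_blocks h.le.1 hD hDX ha
  obtain ⟨Y, h1, h2, h3⟩ := exists_merge hgen hP h.le hA hB hAB hD hAD hBD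
  exact ⟨Y, A, B, h1, h2, h3⟩

theorem card_lt_of_lt (hgen : ∀ {k : ℕ} (p : P.Op k), P.IsTreeValue p)
    (hP : P.IsWeaklyAssociative) {X Z : P.Partition n} (h : X < Z) :
    Z.part.parts.card < X.part.parts.card := by
  obtain ⟨Y, A, B, -, h2, h3⟩ := exists_merge_of_lt hgen hP h
  have h4 := h3.card
  have h5 := Finpartition.card_mono h2.1
  omega

/-- Between `X < Z` one merge always fits, so the number of blocks is a rank function. -/
theorem covBy_iff (hgen : ∀ {k : ℕ} (p : P.Op k), P.IsTreeValue p)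
    (hP : P.IsWeaklyAssociative) {X Z : P.Partition n} :
    X ⋖ Z ↔ X ≤ Z ∧ Z.part.parts.card + 1 = X.part.parts.card := by
  constructor
  · intro h
    obtain ⟨Y, A, B, h1, h2, h3⟩ := exists_merge_of_lt hgen hP h.lt
    have h4 := h3.card
    rcases h2.eq_or_lt with rfl | hlt
    · exact ⟨h1, h4⟩
    · refine absurd hlt (h.2 (lt_of_le_of_ne h1 ?_))
      rintro rfl
      omega
  · rintro ⟨h1, h2⟩
    refine ⟨lt_of_le_of_ne h1 ?_, fun Y hXY hYZ => ?_⟩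
    · rintro rfl
      omega
    · have h3 := card_lt_of_lt hgen hP hXY
      have h4 := card_lt_of_lt hgen hP hYZ
      omega

theorem exists_isMerge_of_covBy (hgen : ∀ {k : ℕ} (p : P.Op k), P.IsTreeValue p)
    (hP : P.IsWeaklyAssociative) {X Z : P.Partition n} (h : X ⋖ Z) :
    ∃ A B, X.part.IsMerge Z.part A B := by
  obtain ⟨Y, A, B, h1, h2, h3⟩ := exists_merge_of_lt hgen hP h.lt
  have h4 := h3.card
  have h5 := ((covBy_iff hgen hP).1 h).2
  rcases h2.eq_or_lt with rfl | hlt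
  · exact ⟨A, B, h3⟩
  · have := card_lt_of_lt hgen hP hlt
    omega

end Covers

end Partition

end SetOperad

/-! ### Sums over the blocks inside a set -/

namespace Finpartition

variable {n : ℕ}

/-- The sum of `f` over the blocks of `π` contained in `D`. -/
def blockSum (π : Finpartition (univ : Finset (Fin n))) (f : Finset (Fin n) → ℕ)
    (D : Finset (Fin n)) : ℕ :=
  ∑ B ∈ π.parts with B ⊆ D, f B

/-- The number of blocks of `π` contained in `D`. -/
def blockCount (π : Finpartition (univ : Finset (Fin n))) (D : Finset (Fin n)) : ℕ :=
  π.blockSum (fun _ => 1) D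

variable {π ρ ζ : Finpartition (univ : Finset (Fin n))} {f g h : Finset (Fin n) → ℕ}
  {B D : Finset (Fin n)}

theorem blockSum_of_mem (hB : B ∈ π.parts) : π.blockSum f B = f B := by
  have : π.parts.filter (· ⊆ B) = {B} := by
    ext C
    simp only [mem_filter, mem_singleton]
    constructor
    · rintro ⟨hC, hCB⟩
      obtain ⟨c, hc⟩ := π.nonempty_of_mem_parts hC
      exact π.eq_of_mem_parts hC hB hc (hCB hc)
    · rintro rfl
      exact ⟨hB, subset_rfl⟩
  rw [blockSum, this, sum_singleton]

theorem blockSum_single (hB : B ∈ π.parts) (k : ℕ) :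
    π.blockSum (fun C => if C = B then k else 0) D = if B ⊆ D then k else 0 := by
  rw [blockSum, sum_ite_eq']
  simp [hB]

theorem blockSum_add : π.blockSum (fun B => f B + g B) D = π.blockSum f D + π.blockSum g D :=
  sum_add_distrib

theorem blockSum_congr (hfg : ∀ B ∈ π.parts, f B = g B) : π.blockSum f D = π.blockSum g D :=
  sum_congr rfl fun B hB => hfg B (mem_filter.1 hB).1

/-- Summation in stages: each block of `π` inside `D` lies in exactly one block of `ρ` inside `D`.
-/
theorem blockSum_refine (hπρ : π ≤ ρ) (hρζ : ρ ≤ ζ) (hD : D ∈ ζ.parts) :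
    ρ.blockSum (π.blockSum f) D = π.blockSum f D := by
  have : π.parts.filter (· ⊆ D) =
      (ρ.parts.filter (· ⊆ D)).biUnion fun B => π.parts.filter (· ⊆ B) := by
    ext A
    simp only [mem_filter, mem_biUnion]
    constructor
    · rintro ⟨hA, hAD⟩
      obtain ⟨B, hB, hAB⟩ := hπρ hA
      obtain ⟨a, ha⟩ := π.nonempty_of_mem_parts hA
      exact ⟨B, ⟨hB, subset_of_le hρζ hB hD (hAB ha) (hAD ha)⟩, hA, hAB⟩
    · rintro ⟨B, ⟨-, hBD⟩, hA, hAB⟩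
      exact ⟨hA, hAB.trans hBD⟩
  rw [blockSum, blockSum, this, sum_biUnion]
  · rfl
  · intro B hB B' hB' hne
    refine Finset.disjoint_left.2 fun A hA hA' => hne ?_
    obtain ⟨hA, hAB⟩ := mem_filter.1 hA
    obtain ⟨a, ha⟩ := π.nonempty_of_mem_parts hA
    exact ρ.eq_of_mem_parts (mem_filter.1 hB).1 (mem_filter.1 hB').1 (hAB ha)
      ((mem_filter.1 hA').2 ha)

theorem blockSum_eq_add_of_eq_add (hπρ : π ≤ ρ) (hρζ : ρ ≤ ζ) (hD : D ∈ ζ.parts)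
    (hg : ∀ B ∈ ρ.parts, g B = π.blockSum f B + h B) :
    ρ.blockSum g D = π.blockSum f D + ρ.blockSum h D := by
  rw [blockSum_congr hg, blockSum_add, blockSum_refine hπρ hρζ hD]

theorem blockCount_eq_add_of_eq_add (hπρ : π ≤ ρ) (hρζ : ρ ≤ ζ) (hD : D ∈ ζ.parts)
    (hg : ∀ B ∈ ρ.parts, π.blockCount B = 1 + h B) :
    π.blockCount D = ρ.blockCount D + ρ.blockSum h D := by
  rw [blockCount, blockCount, ← blockSum_refine hπρ hρζ hD, ← blockSum_add]
  exact blockSum_congr hg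

theorem blockCount_pos (hB : B ∈ π.parts) (hBD : B ⊆ D) : 0 < π.blockCount D :=
  sum_pos (fun _ _ => one_pos) ⟨B, mem_filter.2 ⟨hB, hBD⟩⟩

theorem blockCount_pos_of_le (hπρ : π ≤ ρ) (hD : D ∈ ρ.parts) : 0 < π.blockCount D := by
  obtain ⟨d, hd⟩ := ρ.nonempty_of_mem_parts hD
  obtain ⟨A, hA, hdA⟩ := π.exists_mem (mem_univ d)
  exact blockCount_pos hA (subset_of_le hπρ hA hD hdA hd)

/-- Each block leaves room for one more unit. This is what keeps sums of weights, with small gains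
added, in the admissible range. -/
theorem blockSum_add_blockCount_le (hf : ∀ B ∈ π.parts, f B < B.card) :
    π.blockSum f D + π.blockCount D ≤ D.card := by
  rw [blockCount, ← blockSum_add]
  calc π.blockSum (fun B => f B + 1) D ≤ ∑ B ∈ π.parts with B ⊆ D, B.card :=
        sum_le_sum fun B hB => hf B (mem_filter.1 hB).1
    _ = ((π.parts.filter (· ⊆ D)).biUnion id).card := by
        rw [card_biUnion]
        · rfl
        · intro B hB B' hB' hne
          exact π.disjoint (mem_filter.1 hB).1 (mem_filter.1 hB').1 hne
    _ ≤ D.card := card_le_card (biUnion_subset.2 fun B hB => (mem_filter.1 hB).2)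

theorem IsMerge.blockSum_union {A B : Finset (Fin n)} (hm : IsMerge π ρ A B) :
    π.blockSum f (A ∪ B) = f A + f B := by
  have : π.parts.filter (· ⊆ A ∪ B) = {A, B} := by
    ext C
    simp only [mem_filter, mem_insert, mem_singleton]
    constructor
    · rintro ⟨hC, hCM⟩
      exact hm.eq_or_eq_of_subset hC hCM
    · rintro (rfl | rfl)
      · exact ⟨hm.left_mem, subset_union_left⟩
      · exact ⟨hm.right_mem, subset_union_right⟩
  rw [blockSum, this, sum_pair hm.ne]

theorem IsMerge.blockCount_union {A B : Finset (Fin n)} (hm : IsMerge π ρ A B) :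
    π.blockCount (A ∪ B) = 2 := hm.blockSum_union

theorem IsMerge.blockCount_eq {A B : Finset (Fin n)} (hm : IsMerge π ρ A B) {C : Finset (Fin n)}
    (hC : C ∈ ρ.parts) : π.blockCount C = 1 + if C = A ∪ B then 1 else 0 := by
  split_ifs with h
  · rw [h, hm.blockCount_union]
  · exact blockSum_of_mem (hm.mem_of_ne hC h)

end Finpartition

/-! ### Weights -/

namespace SetOperad

variable {P : SetOperad.{u}} {n : ℕ}

/-- A pair of an operation and a weight. -/
def tcMk {k : ℕ} (p : P.Op k) (i : Fin k) : P.tc.Op k := (p, i)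

theorem tc_comp₂_fst {a b n : ℕ} (c : P.tc.Op 2) (p : P.tc.Op a) (q : P.tc.Op b)
    (σ : Fin a ⊕ Fin b ≃ Fin n) :
    (P.tc.comp₂ c p q σ).1 = P.comp₂ c.1 p.1 q.1 σ := by
  unfold comp₂
  show P.comp _ _ _ _ = _
  congr 1
  funext i
  fin_cases i <;> rfl

theorem tc_comp₂_snd {a b n : ℕ} (c : P.tc.Op 2) (p : P.tc.Op a) (q : P.tc.Op b)
    (σ : Fin a ⊕ Fin b ≃ Fin n) :
    ((P.tc.comp₂ c p q σ).2 : Fin n).val =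
      (c.2 : Fin 2).val + ((p.2 : Fin a).val + (q.2 : Fin b).val) := by
  show (c.2 : Fin 2).val + ∑ i : Fin 2, _ = _
  rw [Fin.sum_univ_two]

/-- A tree for the underlying operation is kept and the weight is distributed over its vertices,
each of which can carry `0` or `1`. -/
theorem tc_isTreeValue (hgen : ∀ {k : ℕ} (p : P.Op k), P.IsTreeValue p) {k : ℕ} (p : P.tc.Op k) :
    P.tc.IsTreeValue p := by
  suffices h : ∀ {k : ℕ} (p : P.Op k), P.IsTreeValue p → ∀ i : Fin k,
      P.tc.IsTreeValue (tcMk p i) from h p.1 (hgen _) p.2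
  intro k p hp
  induction hp with
  | leaf =>
    intro i
    obtain rfl := Subsingleton.elim i 0
    exact .leaf
  | @node a b n c p q σ hp hq ihp ihq =>
    intro i
    have hn := Fintype.card_congr σ
    simp only [Fintype.card_sum, Fintype.card_fin] at hn
    have ha : 0 < a := Nat.pos_of_ne_zero fun h => by subst h; exact P.isEmpty_zero.false p
    have hb : 0 < b := Nat.pos_of_ne_zero fun h => by subst h; exact P.isEmpty_zero.false q
    obtain ⟨w, i₁, i₂, hw, h₁, h₂, hi⟩ : ∃ w i₁ i₂ : ℕ, w < 2 ∧ i₁ < a ∧ i₂ < b ∧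
        w + (i₁ + i₂) = i := by
      have := i.2
      -- The left subtree is filled first, up to its maximum `a - 1`; then the root takes `1` and
      -- the right subtree the rest.
      rcases Nat.lt_or_ge i a with h | h
      · exact ⟨0, i, 0, by omega, h, hb, by omega⟩
      · exact ⟨1, a - 1, i - a, by omega, by omega, by omega, by omega⟩
    have := IsTreeValue.node (P := P.tc) (tcMk c ⟨w, hw⟩) _ _ σ (ihp ⟨i₁, h₁⟩) (ihq ⟨i₂, h₂⟩)
    convert this using 1
    exact Prod.ext (tc_comp₂_fst (tcMk c ⟨w, hw⟩) (tcMk p ⟨i₁, h₁⟩) (tcMk q ⟨i₂, h₂⟩) σ).symm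
      (Fin.ext (hi.symm.trans
        (tc_comp₂_snd (tcMk c ⟨w, hw⟩) (tcMk p ⟨i₁, h₁⟩) (tcMk q ⟨i₂, h₂⟩) σ).symm))

/-- Only the sum of the two weights matters, so they can be carried over to the vertices of the
other tree. -/
theorem tc_isWeaklyAssociative (hP : P.IsWeaklyAssociative) : P.tc.IsWeaklyAssociative := by
  intro i j
  obtain ⟨k, l, hkl⟩ := hP i.1 j.1
  exact ⟨tcMk k i.2, tcMk l j.2, Prod.ext
    ((tc_comp₂_fst _ _ _ _).trans
      (hkl.trans (tc_comp₂_fst (tcMk l j.2) P.tc.one (tcMk k i.2) _).symm))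
    (Fin.ext ((tc_comp₂_snd _ _ _ _).trans ((congrArg _ (add_comm _ _)).trans
      (tc_comp₂_snd (tcMk l j.2) P.tc.one (tcMk k i.2) _).symm)))⟩

namespace Partition

/-- The weight of a block of a weighted partition. -/
def wt (α : tcCom.Partition n) (B : Finset (Fin n)) : ℕ :=
  if h : B ∈ α.part.parts then (α.dec ⟨B, h⟩ : Fin B.card).val else 0

theorem wt_of_mem (α : tcCom.Partition n) {B : Finset (Fin n)} (h : B ∈ α.part.parts) :
    α.wt B = (α.dec ⟨B, h⟩ : Fin B.card).val := dif_pos h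

theorem wt_of_mem_blocks {α : tcCom.Partition n} {b : tcCom.DecoratedSet n} (hb : b ∈ α.blocks) :
    α.wt b.1 = (b.2 : Fin b.1.card).val := by
  obtain ⟨B, rfl⟩ := hb
  exact wt_of_mem α B.2

theorem wt_lt (α : tcCom.Partition n) {B : Finset (Fin n)} (h : B ∈ α.part.parts) :
    α.wt B < B.card := by
  rw [wt_of_mem α h]
  exact (α.dec ⟨B, h⟩ : Fin B.card).2

theorem blockSum_eq_sum {X : P.Partition n} {k : ℕ} {p : P.Op k} {ds : Fin k → P.DecoratedSet n}
    {b : P.DecoratedSet n} (h : IsComp p ds b) (hX : ∀ i, ds i ∈ X.blocks)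
    (f : Finset (Fin n) → ℕ) : X.part.blockSum f b.1 = ∑ i, f (ds i).1 := by
  have : X.part.parts.filter (· ⊆ b.1) = univ.image fun i => (ds i).1 := by
    ext B
    simp only [mem_filter, mem_image, mem_univ, true_and]
    constructor
    · rintro ⟨hB, hBb⟩
      obtain ⟨x, hx⟩ := X.part.nonempty_of_mem_parts hB
      obtain ⟨i, hi⟩ := (h.mem_iff x).1 (hBb hx)
      exact ⟨i, X.part.eq_of_mem_parts (mem_parts_of_mem_blocks (hX i)) hB hi hx⟩
    · rintro ⟨i, rfl⟩
      exact ⟨mem_parts_of_mem_blocks (hX i), h.subset i⟩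
  rw [Finpartition.blockSum, this, sum_image]
  intro i _ j _ hij
  obtain ⟨x, hx⟩ := (ds i).nonempty
  exact h.eq_of_mem hx ((show (ds i).1 = (ds j).1 from hij) ▸ hx)

theorem blockCount_eq_card {X : P.Partition n} {k : ℕ} {p : P.Op k}
    {ds : Fin k → P.DecoratedSet n} {b : P.DecoratedSet n} (h : IsComp p ds b)
    (hX : ∀ i, ds i ∈ X.blocks) : X.part.blockCount b.1 = k := by
  rw [Finpartition.blockCount, blockSum_eq_sum h hX]
  simp

theorem tcCom_le_iff {α β : tcCom.Partition n} : α ≤ β ↔ α.part ≤ β.part ∧ ∀ D ∈ β.part.parts,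
    α.part.blockSum α.wt D ≤ β.wt D ∧
      β.wt D + 1 ≤ α.part.blockSum α.wt D + α.part.blockCount D := by
  rw [le_iff]
  refine and_congr_right fun hle => ⟨fun h D hD => ?_, fun h b hb => ?_⟩
  · obtain ⟨b, hb, rfl⟩ := exists_mem_blocks hD
    obtain ⟨k, p, ds, hds, hα⟩ := h b hb
    rw [blockCount_eq_card hds hα, blockSum_eq_sum hds hα, wt_of_mem_blocks hb,
      sum_congr rfl fun i _ => wt_of_mem_blocks (hα i)]
    obtain ⟨e, -, hb'⟩ := hds
    have h1 : (b.2 : Fin _).val = (p : Fin k).val + ∑ i, ((ds i).2 : Fin _).val :=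
      congrArg Fin.val hb'
    have h2 := (p : Fin k).2
    omega
  · obtain ⟨h1, h2⟩ := h b.1 (mem_parts_of_mem_blocks hb)
    let s := α.part.parts.filter (· ⊆ b.1)
    let ε : Fin (α.part.blockCount b.1) ≃ s := (finCongr (by
      simp [s, Finpartition.blockCount, Finpartition.blockSum])).trans s.equivFin.symm
    have hex : ∀ i, ∃ d ∈ α.blocks, d.1 = (ε i : Finset (Fin n)) := fun i =>
      exists_mem_blocks (mem_filter.1 (ε i).2).1
    choose ds hds hε using hex
    -- The root operation is forced: its weight is the gain, which is less than the number of merged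
    -- blocks.
    let p : Fin (α.part.blockCount b.1) := ⟨β.wt b.1 - α.part.blockSum α.wt b.1, by omega⟩
    obtain ⟨b', hb'⟩ := IsComp.exists_of_disjoint (P := tcCom) p ds fun i j a hi hj => by
      have := congrArg Sigma.fst (eq_of_mem_blocks (hds i) (hds j) hi hj)
      rw [hε, hε] at this
      exact ε.injective (Subtype.ext this)
    have hbb : b'.1 = b.1 := by
      ext a
      rw [hb'.mem_iff]
      constructor
      · rintro ⟨i, hi⟩
        exact (mem_filter.1 (ε i).2).2 (hε i ▸ hi)
      · intro ha
        obtain ⟨A, hA, haA⟩ := α.part.exists_mem (mem_univ a)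
        have hAb := Finpartition.subset_of_le hle hA (mem_parts_of_mem_blocks hb) haA ha
        obtain ⟨i, hi⟩ := ε.surjective ⟨A, mem_filter.2 ⟨hA, hAb⟩⟩
        exact ⟨i, by rw [hε, hi]; exact haA⟩
    refine ⟨_, p, ds, ?_, hds⟩
    have hsum := blockSum_eq_sum hb' hds α.wt
    rw [sum_congr rfl fun i _ => wt_of_mem_blocks (hds i), hbb] at hsum
    have hval : (b'.2 : Fin _).val = (b.2 : Fin _).val := by
      obtain ⟨e, -, he⟩ := hb'
      have : (b'.2 : Fin _).val = (p : Fin _).val + ∑ i, ((ds i).2 : Fin _).val :=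
        congrArg Fin.val he
      rw [this, ← hsum, ← wt_of_mem_blocks hb]
      simp only [p]
      omega
    obtain ⟨B, q⟩ := b
    obtain ⟨B', q'⟩ := b'
    obtain rfl : B' = B := hbb
    obtain rfl : q' = q := Fin.ext hval
    exact hb'

/-- The weight of a block of a partition decorated by two totally compatible structures. -/
def tcWt (X : P.tc.Partition n) : Finset (Fin n) → ℕ := X.weights.wt

theorem tcWt_lt (X : P.tc.Partition n) {B : Finset (Fin n)} (h : B ∈ X.part.parts) :
    X.tcWt B < B.card := wt_lt _ h

theorem tc_le_iff {X Y : P.tc.Partition n} : X ≤ Y ↔ X.forgetWeights ≤ Y.forgetWeights ∧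
    ∀ D ∈ Y.part.parts, X.part.blockSum X.tcWt D ≤ Y.tcWt D ∧
      Y.tcWt D + 1 ≤ X.part.blockSum X.tcWt D + X.part.blockCount D := by
  constructor
  · intro h
    rw [le_iff] at h
    refine ⟨le_iff.2 ⟨h.1, ?_⟩, (tcCom_le_iff (α := X.weights) (β := Y.weights).1
      (le_iff.2 ⟨h.1, ?_⟩)).2⟩
    · rintro b ⟨B, rfl⟩
      obtain ⟨k, p, ds, ⟨e, he, hq⟩, hX⟩ := h.2 _ ⟨B, rfl⟩
      refine ⟨k, p.1, fun i => ⟨(ds i).1, (ds i).2.1⟩, ⟨e, he, congrArg Prod.fst hq⟩, fun i => ?_⟩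
      obtain ⟨A, hA⟩ := hX i
      exact ⟨A, congrArg (fun d : P.tc.DecoratedSet n => (⟨d.1, d.2.1⟩ : P.DecoratedSet n)) hA⟩
    · rintro b ⟨B, rfl⟩
      obtain ⟨k, p, ds, ⟨e, he, hq⟩, hX⟩ := h.2 _ ⟨B, rfl⟩
      refine ⟨k, p.2, fun i => ⟨(ds i).1, (ds i).2.2⟩, ⟨e, he, congrArg Prod.snd hq⟩, fun i => ?_⟩
      obtain ⟨A, hA⟩ := hX i
      exact ⟨A, congrArg (fun d : P.tc.DecoratedSet n =>
        (⟨d.1, d.2.2⟩ : tcCom.DecoratedSet n)) hA⟩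
  · rintro ⟨h1, h2⟩
    refine ⟨h1.1, fun B => ?_⟩
    obtain ⟨h3, h4⟩ := h2 B B.2
    obtain ⟨k, p, ds, hds, hX⟩ := (le_iff.1 h1).2 _ ⟨B, rfl⟩
    have hk : X.part.blockCount B = k := blockCount_eq_card hds hX
    have hsum : X.part.blockSum X.tcWt B = ∑ i, X.tcWt (ds i).1 := blockSum_eq_sum hds hX _
    choose a ha using hX
    obtain rfl : (fun i => (⟨a i, (X.dec (a i)).1⟩ : P.DecoratedSet n)) = ds := funext ha
    obtain ⟨e, he, hq⟩ := hds
    refine isComposite_iff (P := P.tc) (X := X) (b := ⟨B, Y.dec B⟩).2 ⟨k,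
      (p, (⟨Y.tcWt B - X.part.blockSum X.tcWt B, by omega⟩ : Fin k)),
      fun i => ⟨a i, X.dec (a i)⟩, ⟨e, he, Prod.ext hq (Fin.ext ?_)⟩, fun i => ⟨a i, rfl⟩⟩
    have h5 : Y.tcWt B = ((Y.dec B).2 : Fin _).val := wt_of_mem Y.weights B.2
    have h6 : ∀ i, X.tcWt (a i) = ((X.dec (a i)).2 : Fin _).val := fun i =>
      wt_of_mem X.weights (a i).2
    have h7 : ∑ i, X.tcWt (a i) = ∑ i, ((X.dec (a i)).2 : Fin _).val :=
      sum_congr rfl fun i _ => h6 i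
    show ((Y.dec B).2 : Fin _).val = (Y.tcWt B - X.part.blockSum X.tcWt B) +
      ∑ i, ((X.dec (a i)).2 : Fin _).val
    have hsum' : X.part.blockSum X.tcWt B = ∑ i, X.tcWt (a i) := hsum
    omega

theorem tc_le_iff_forget_weights {X Y : P.tc.Partition n} :
    X ≤ Y ↔ X.forgetWeights ≤ Y.forgetWeights ∧ X.weights ≤ Y.weights := by
  rw [tc_le_iff, tcCom_le_iff]
  exact ⟨fun h => ⟨h.1, h.1.1, h.2⟩, fun h => ⟨h.1, h.2.2⟩⟩

/-- The poset of partitions decorated by two totally compatible structures is a fiber product. -/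
theorem exists_orderIso_fiberProduct [P.IsReduced] (n : ℕ) :
    ∃ φ : P.tc.Partition n ≃o
        FiberProduct (fun α : P.Partition n => α.part)
          (fun β : SetOperad.tcCom.Partition n => β.part),
      ∀ γ : P.tc.Partition n, (φ γ).1 = (γ.forgetWeights, γ.weights) := by
  let ψ : P.tc.Partition n ↪o FiberProduct (fun α : P.Partition n => α.part)
      (fun β : SetOperad.tcCom.Partition n => β.part) :=
    OrderEmbedding.ofMapLEIff (fun γ => ⟨(γ.forgetWeights, γ.weights), rfl⟩)
      fun X Y => tc_le_iff_forget_weights.symm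
  refine ⟨RelIso.ofSurjective ψ ?_, fun γ => rfl⟩
  rintro ⟨⟨⟨π, f⟩, ⟨ρ, g⟩⟩, h⟩
  obtain rfl : π = ρ := h
  exact ⟨⟨π, fun B => (f B, g B)⟩, rfl⟩

/-- Equip a `P`-partition with weights. -/
def withWeights (X : P.Partition n) (f : Finset (Fin n) → ℕ)
    (hf : ∀ B ∈ X.part.parts, f B < B.card) : P.tc.Partition n where
  part := X.part
  dec B := (X.dec B, (⟨f B, hf B B.2⟩ : Fin _))

theorem tcWt_withWeights (X : P.Partition n) {f : Finset (Fin n) → ℕ}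
    (hf : ∀ B ∈ X.part.parts, f B < B.card) {B : Finset (Fin n)} (hB : B ∈ X.part.parts) :
    (X.withWeights f hf).tcWt B = f B :=
  wt_of_mem (X.withWeights f hf).weights hB

/-- Anything above `γ.forgetWeights` lifts to something above `γ`: each block receives the sum of
the weights merged into it, with gain zero. -/
theorem isMax_forgetWeights {γ : P.tc.Partition n} (hγ : IsMax γ) : IsMax γ.forgetWeights := by
  intro δ hδ
  have hpos : ∀ B ∈ δ.part.parts, 0 < γ.part.blockCount B := fun B hB =>
    Finpartition.blockCount_pos_of_le hδ.1 hB
  have hf : ∀ B ∈ δ.part.parts, γ.part.blockSum γ.tcWt B < B.card := fun B hB => by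
    have h1 := Finpartition.blockSum_add_blockCount_le (D := B) fun _ => tcWt_lt γ
    have h2 := hpos B hB
    omega
  have hle : γ ≤ δ.withWeights _ hf := tc_le_iff.2 ⟨hδ, fun D hD => by
    have h2 := hpos D hD
    rw [tcWt_withWeights δ hf hD]
    omega⟩
  exact (tc_le_iff.1 (hγ hle)).1

theorem eq_of_forgetWeights_eq {X Y : P.tc.Partition n} (h : X.forgetWeights = Y.forgetWeights)
    (hw : ∀ B ∈ X.part.parts, X.tcWt B = Y.tcWt B) : X = Y := by
  obtain ⟨π, f⟩ := X
  obtain ⟨ρ, g⟩ := Y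
  obtain rfl : π = ρ := congrArg Partition.part h
  congr 1
  funext B
  refine Prod.ext ?_ (Fin.ext ?_)
  · have h1 := Partition.mk.inj h
    exact congrFun (eq_of_heq h1.2) B
  · have h1 := hw B B.2
    unfold tcWt at h1
    rw [wt_of_mem _ B.2, wt_of_mem _ B.2] at h1
    exact h1

/-- There are finitely many weighted partitions, and an element is determined by its two underlying
partitions. -/
theorem finite_Icc_bot {γ : P.tc.Partition n} [P.IsReduced]
    (h : Finite (Set.Icc ⊥ γ.forgetWeights)) : Finite (Set.Icc ⊥ γ) := by
  have : Finite (tcCom.Partition n) := by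
    have : ∀ π : Finpartition (univ : Finset (Fin n)),
        Finite ((B : π.parts) → tcCom.Op (B : Finset (Fin n)).card) := fun π => by
      have : ∀ B : π.parts, Finite (tcCom.Op (B : Finset (Fin n)).card) := fun B =>
        inferInstanceAs (Finite (Fin _))
      infer_instance
    refine Finite.of_injective (β := Σ π : Finpartition (univ : Finset (Fin n)),
      (B : π.parts) → tcCom.Op (B : Finset (Fin n)).card) (fun X => ⟨X.part, X.dec⟩) ?_
    rintro ⟨π, f⟩ ⟨ρ, g⟩ h
    obtain ⟨rfl, h2⟩ := Sigma.mk.inj_iff.1 h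
    obtain rfl := eq_of_heq h2
    rfl
  refine Finite.of_injective (β := Set.Icc ⊥ γ.forgetWeights × tcCom.Partition n)
    (fun X => (⟨X.1.forgetWeights, bot_le, (tc_le_iff.1 X.2.2).1⟩, X.1.weights)) ?_
  rintro ⟨X, hX⟩ ⟨Y, hY⟩ h
  obtain ⟨h1, h2⟩ := Prod.mk.inj h
  refine Subtype.ext (eq_of_forgetWeights_eq (Subtype.mk.inj h1) fun B _ => ?_)
  exact congrArg (fun α => wt α B) h2

end Partition

end SetOperad

/-! ### The least element of the merged block -/

namespace Finpartition

variable {n : ℕ}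

/-- The least element whose block changes from `π` to `ρ`. -/
noncomputable def mergeKey (π ρ : Finpartition (univ : Finset (Fin n))) : ℕ :=
  -- Defined for all pairs without a choice of merged blocks. The value `sInf ∅ = 0` for `π = ρ`
  -- plays no role, as only covers are compared.
  sInf {k | ∃ a : Fin n, (a : ℕ) = k ∧ π.part a ≠ ρ.part a}

variable {π ρ : Finpartition (univ : Finset (Fin n))} {A B : Finset (Fin n)}

theorem IsMerge.part_ne_iff (h : IsMerge π ρ A B) (a : Fin n) :
    π.part a ≠ ρ.part a ↔ a ∈ A ∪ B := by
  constructor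
  · contrapose!
    intro ha
    obtain ⟨C, hC, haC⟩ := ρ.exists_mem (mem_univ a)
    rw [ρ.part_eq_of_mem hC haC,
      π.part_eq_of_mem (h.mem_of_ne hC fun he => ha (he ▸ haC)) haC]
  · intro ha he
    rw [ρ.part_eq_of_mem h.union_mem ha] at he
    exact h.union_notMem (he ▸ π.part_mem.2 (mem_univ a))

theorem IsMerge.mergeKey_le (h : IsMerge π ρ A B) {a : Fin n} (ha : a ∈ A ∪ B) :
    mergeKey π ρ ≤ a :=
  Nat.sInf_le ⟨a, rfl, (h.part_ne_iff a).2 ha⟩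

theorem IsMerge.exists_mergeKey (h : IsMerge π ρ A B) : ∃ a ∈ A ∪ B, (a : ℕ) = mergeKey π ρ := by
  obtain ⟨a₀, ha₀⟩ := π.nonempty_of_mem_parts h.left_mem
  obtain ⟨a, ha, hne⟩ := Nat.sInf_mem (s := {k | ∃ a : Fin n, (a : ℕ) = k ∧ π.part a ≠ ρ.part a})
    ⟨a₀, a₀, rfl, (h.part_ne_iff a₀).2 (mem_union_left _ ha₀)⟩
  exact ⟨a, (h.part_ne_iff a).1 hne, ha⟩

theorem IsMerge.symm (h : IsMerge π ρ A B) : IsMerge π ρ B A :=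
  ⟨h.right_mem, h.left_mem, h.ne.symm, by rw [h.parts_eq, union_comm, erase_right_comm]⟩

theorem exists_superset_of_le (h : π ≤ ρ) (hA : A ∈ π.parts) : ∃ D ∈ ρ.parts, A ⊆ D := h hA

end Finpartition

namespace SetOperad.Partition

open Finpartition

variable {P : SetOperad.{u}} {n : ℕ}

section Key

variable [P.IsReduced]

/-- The merged block survives in `Y`, which fixes its decoration from above; the other blocks come
from `X₀`, which fixes theirs from below. -/
theorem eq_of_isMerge {X₀ X X' Y : P.Partition n} (h₀ : X₀ ≤ X) (h₀' : X₀ ≤ X') (h : X ≤ Y)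
    (h' : X' ≤ Y) {A B : Finset (Fin n)} (hm : IsMerge X₀.part X.part A B)
    (hp : X.part = X'.part) (hY : A ∪ B ∈ Y.part.parts) : X = X' := by
  refine eq_of_blocks_subset fun b hb => ?_
  have hbp := mem_parts_of_mem_blocks hb
  obtain ⟨b', hb', he'⟩ := exists_mem_blocks (hp ▸ hbp)
  by_cases hbM : b.1 = A ∪ B
  · obtain ⟨c, hc, he⟩ := exists_mem_blocks hY
    rw [eq_of_le_of_mem_blocks h hb hc (hbM.trans he.symm),
      ← eq_of_le_of_mem_blocks h' hb' hc (he'.trans (hbM.trans he.symm))]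
    exact hb'
  · obtain ⟨c, hc, he⟩ := exists_mem_blocks (hm.mem_of_ne hbp hbM)
    rw [← eq_of_le_of_mem_blocks h₀ hc hb he,
      eq_of_le_of_mem_blocks h₀' hc hb' (he.trans he'.symm)]
    exact hb'

variable (hgen : ∀ {k : ℕ} (p : P.Op k), P.IsTreeValue p) (hP : P.IsWeaklyAssociative)
include hgen hP

/-- The block `E` of `Y` around the block merged in `X'` must be the one created from `X` to `Y`, so
it contains the least element of `A' ∪ B'`. If `E` were instead `A ∪ B`, then `X = X'`; and no block
of `X₀` contains `A' ∪ B'`. -/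
theorem mergeKey_le_of_covBy {X₀ X X' Y : P.Partition n} (h₁ : X₀ ⋖ X) (h₂ : X ⋖ Y) (h₁' : X₀ ⋖ X')
    (h₂' : X' ⋖ Y) (hne : X ≠ X') (hk : mergeKey X₀.part X'.part ≤ mergeKey X₀.part X.part) :
    mergeKey X.part Y.part ≤ mergeKey X₀.part X.part := by
  obtain ⟨A, B, hm⟩ := exists_isMerge_of_covBy hgen hP h₁
  obtain ⟨C, D, hm₂⟩ := exists_isMerge_of_covBy hgen hP h₂
  obtain ⟨A', B', hm'⟩ := exists_isMerge_of_covBy hgen hP h₁'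
  obtain ⟨E, hE, hME⟩ := exists_superset_of_le h₂'.le.1 hm'.union_mem
  by_cases hEN : E = C ∪ D
  · obtain ⟨a, ha, hak⟩ := hm'.exists_mergeKey
    exact (hm₂.mergeKey_le (hEN ▸ hME ha)).trans (hak.trans_le hk)
  · by_cases hEM : E = A ∪ B
    · subst hEM
      have hp := hm.part_eq_of_union_eq hm' (hm.union_eq_of_subset hm' hME)
      exact absurd (eq_of_isMerge h₁.le h₁'.le h₂.le h₂'.le hm hp hE) hne
    · exact (hm'.eq_of_subset_of_mem (hm.mem_of_ne (hm₂.mem_of_ne hE hEN) hEM) hME).elim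

/-- The block of `X₀` containing the least element of `C ∪ D` can be merged at once with another
block of `X₀` inside `C ∪ D`. -/
theorem exists_covBy_mergeKey_lt {X₀ X Y : P.Partition n} (h₁ : X₀ ⋖ X) (h₂ : X ⋖ Y)
    (hk : mergeKey X.part Y.part < mergeKey X₀.part X.part) :
    ∃ X', X₀ ⋖ X' ∧ X' ⋖ Y ∧ mergeKey X₀.part X'.part < mergeKey X₀.part X.part := by
  obtain ⟨C, D, hm⟩ := exists_isMerge_of_covBy hgen hP h₂
  obtain ⟨a, ha, hak⟩ := hm.exists_mergeKey
  have hN : C ∪ D ∉ X₀.part.parts := fun h => by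
    obtain ⟨E, hE, hs⟩ := exists_superset_of_le h₁.le.1 h
    exact hm.eq_of_subset_of_mem hE hs
  have hle := h₁.le.trans h₂.le
  obtain ⟨A, hA, B, hB, hAB, hAD, hBD, haA⟩ := exists_two_blocks hle.1 hm.union_mem hN ha
  obtain ⟨X', h3, h4, hm'⟩ := exists_merge hgen hP hle hA hB hAB hm.union_mem hAD hBD
  have c1 := ((covBy_iff hgen hP).1 h₁).2
  have c2 := ((covBy_iff hgen hP).1 h₂).2
  have c3 := hm'.card
  refine ⟨X', (covBy_iff hgen hP).2 ⟨h3, c3⟩, (covBy_iff hgen hP).2 ⟨h4, by omega⟩, ?_⟩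
  exact (hm'.mergeKey_le (mem_union_left _ haA)).trans_lt (hak.trans_lt hk)

end Key

/-! ### Common covers -/

theorem tcWt_eq_of_le {X Y : P.tc.Partition n} (h : X ≤ Y) {B : Finset (Fin n)}
    (hX : B ∈ X.part.parts) (hY : B ∈ Y.part.parts) : Y.tcWt B = X.tcWt B := by
  have h1 := (tc_le_iff.1 h).2 B hY
  rw [blockCount, blockSum_of_mem hX, blockSum_of_mem hX] at h1
  omega

/-- The effect of a cover on the total weights and the numbers of blocks. -/
theorem exists_gain {X Y : P.tc.Partition n} (h : X ≤ Y) {A B : Finset (Fin n)}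
    (hm : IsMerge X.part Y.part A B) :
    ∃ w ≤ 1, ∀ (ζ : Finpartition (univ : Finset (Fin n))), Y.part ≤ ζ → ∀ D ∈ ζ.parts,
      Y.part.blockSum Y.tcWt D = X.part.blockSum X.tcWt D + (if A ∪ B ⊆ D then w else 0) ∧
      X.part.blockCount D = Y.part.blockCount D + (if A ∪ B ⊆ D then 1 else 0) := by
  have h1 := (tc_le_iff.1 h).2 _ hm.union_mem
  rw [hm.blockCount_union] at h1
  -- Two blocks are merged, so the gain on `A ∪ B` is `0` or `1`; nothing changes elsewhere.
  refine ⟨Y.tcWt (A ∪ B) - X.part.blockSum X.tcWt (A ∪ B), by omega, fun ζ hζ D hD => ⟨?_, ?_⟩⟩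
  · rw [blockSum_eq_add_of_eq_add hm.le hζ hD fun C hC => ?_, blockSum_single hm.union_mem]
    split_ifs with hC'
    · subst hC'
      omega
    · have := hm.mem_of_ne hC hC'
      rw [blockSum_of_mem this, tcWt_eq_of_le h this hC]
      rfl
  · rw [blockCount_eq_add_of_eq_add hm.le hζ hD fun C hC => hm.blockCount_eq hC,
      blockSum_single hm.union_mem]

section CommonCover

variable [P.IsReduced] (hgen : ∀ {k : ℕ} (p : P.Op k), P.IsTreeValue p)
  (hP : P.IsWeaklyAssociative)
include hgen hP

theorem tc_covBy_iff {X Y : P.tc.Partition n} :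
    X ⋖ Y ↔ X ≤ Y ∧ Y.part.parts.card + 1 = X.part.parts.card :=
  covBy_iff (fun p => tc_isTreeValue hgen p) (tc_isWeaklyAssociative hP)

theorem forgetWeights_covBy {X Y : P.tc.Partition n} (h : X ⋖ Y) :
    X.forgetWeights ⋖ Y.forgetWeights := by
  rw [tc_covBy_iff hgen hP] at h
  exact (covBy_iff hgen hP).2 ⟨(tc_le_iff.1 h.1).1, h.2⟩

theorem exists_unweighted_common_cover {X Y Y' Z : P.tc.Partition n} (h : X ⋖ Y) (h' : X ⋖ Y')
    (hne : Y ≠ Y') (hZ : Y ≤ Z) (hZ' : Y' ≤ Z)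
    (hsm : Y.forgetWeights ≠ Y'.forgetWeights → ∃ W ≤ Z.forgetWeights,
      Y.forgetWeights ⋖ W ∧ Y'.forgetWeights ⋖ W)
    {A B A' B' : Finset (Fin n)} (hm : IsMerge X.part Y.part A B)
    (hm' : IsMerge X.part Y'.part A' B') {a : Fin n} (ha : a ∈ A ∪ B) (ha' : a ∈ A' ∪ B') :
    ∃ W ≤ Z.forgetWeights, Y.forgetWeights ≤ W ∧ Y'.forgetWeights ≤ W ∧
      ∃ E, IsMerge Y.part W.part (A ∪ B) E ∧ A' ∪ B' ⊆ (A ∪ B) ∪ E := by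
  by_cases heq : Y.forgetWeights = Y'.forgetWeights
  · have hp : Y.part = Y'.part := congrArg (fun α : P.Partition n => α.part) heq
    have hMM : A' ∪ B' = A ∪ B := by
      by_contra hMM
      exact hm'.union_notMem (hm.mem_of_ne (hp ▸ hm'.union_mem) hMM)
    obtain ⟨D, hD, hMD⟩ := exists_superset_of_le hZ.1 hm.union_mem
    -- Here `Y` and `Y'` differ only in the weight of `A ∪ B`. If `A ∪ B` were a block of `Z`, that
    -- weight would be forced. So there is another block to merge with.
    have hDY : D ∉ Y.part.parts := by
      intro hDY
      obtain rfl := Y.part.eq_of_mem_parts hm.union_mem hDY ha (hMD ha)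
      refine hne (eq_of_forgetWeights_eq heq fun C hC => ?_)
      by_cases hCM : C = A ∪ B
      · subst hCM
        rw [← tcWt_eq_of_le hZ hC hD, ← tcWt_eq_of_le hZ' (hp ▸ hC) hD]
      · have := hm.mem_of_ne hC hCM
        rw [tcWt_eq_of_le h.le this hC, tcWt_eq_of_le h'.le this (hp ▸ hC)]
    obtain ⟨M, hM, E, hE, hME, hMD', hED, haM⟩ := exists_two_blocks hZ.1 hD hDY (hMD ha)
    obtain rfl := Y.part.eq_of_mem_parts hM hm.union_mem haM ha
    obtain ⟨W, h1, h2, h3⟩ := exists_merge (fun p => tc_isTreeValue hgen p)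
      (tc_isWeaklyAssociative hP) hZ hM hE hME hD hMD' hED
    exact ⟨W.forgetWeights, (tc_le_iff.1 h2).1, (tc_le_iff.1 h1).1, heq ▸ (tc_le_iff.1 h1).1,
      E, h3, hMM ▸ subset_union_left⟩
  · obtain ⟨W, hWZ, hYW, hYW'⟩ := hsm heq
    obtain ⟨C, D, hW⟩ := exists_isMerge_of_covBy hgen hP hYW
    have hMW : A ∪ B ∉ W.part.parts := by
      intro hMW
      have hs := subset_of_le hYW'.le.1 hm'.union_mem hMW ha' ha
      have hp := hm.part_eq_of_union_eq hm' (hm.union_eq_of_subset hm' hs)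
      exact heq (eq_of_isMerge (tc_le_iff.1 h.le).1 (tc_le_iff.1 h'.le).1 hYW.le hYW'.le hm hp hMW)
    obtain ⟨E, hE⟩ : ∃ E, IsMerge Y.part W.part (A ∪ B) E := by
      by_contra! hE
      refine hMW (hW.mem_iff.2 (.inr ⟨hm.union_mem, ?_, ?_⟩))
      · rintro rfl
        exact hE _ hW
      · rintro rfl
        exact hE _ hW.symm
    exact ⟨W, hWZ, hYW.le, hYW'.le, E, hE,
      subset_of_le hYW'.le.1 hm'.union_mem hE.union_mem ha' (mem_union_left _ ha)⟩

/-- When the merged blocks meet, the common cover merges three blocks of `X` into one block `N`. The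
gain on `N` ranges over `{0, 1, 2}`, enough to fit both `Y` and `Y'`. -/
theorem exists_common_cover_of_mem {X Y Y' Z : P.tc.Partition n} (h : X ⋖ Y) (h' : X ⋖ Y')
    (hne : Y ≠ Y') (hZ : Y ≤ Z) (hZ' : Y' ≤ Z)
    (hsm : Y.forgetWeights ≠ Y'.forgetWeights → ∃ W ≤ Z.forgetWeights,
      Y.forgetWeights ⋖ W ∧ Y'.forgetWeights ⋖ W)
    {A B A' B' : Finset (Fin n)} (hm : IsMerge X.part Y.part A B)
    (hm' : IsMerge X.part Y'.part A' B') {a : Fin n} (ha : a ∈ A ∪ B) (ha' : a ∈ A' ∪ B') :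
    ∃ W ≤ Z, Y ⋖ W ∧ Y' ⋖ W := by
  obtain ⟨W, hWZ, hYW, hYW', E, hE, hs⟩ :=
    exists_unweighted_common_cover hgen hP h h' hne hZ hZ' hsm hm hm' ha ha'
  set N := A ∪ B ∪ E with hN
  have hNW : N ∈ W.part.parts := hE.union_mem
  obtain ⟨w, hw, hgain⟩ := exists_gain h.le hm
  obtain ⟨w', hw', hgain'⟩ := exists_gain h'.le hm'
  have hXW : X.part ≤ W.part := h.le.1.trans hYW.1
  have hMN : ∀ C ∈ W.part.parts, A ∪ B ⊆ C ↔ C = N := fun C hC =>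
    ⟨fun hMC => W.part.eq_of_mem_parts hC hNW (hMC ha) (mem_union_left _ ha), fun hCN =>
      hCN ▸ subset_union_left⟩
  have hMN' : ∀ C ∈ W.part.parts, A' ∪ B' ⊆ C ↔ C = N := fun C hC =>
    ⟨fun hMC => W.part.eq_of_mem_parts hC hNW (hMC ha') (hs ha'), fun hCN => hCN ▸ hs⟩
  have hcount : ∀ C ∈ W.part.parts, X.part.blockCount C = 1 + if C = N then 2 else 0 := by
    intro C hC
    rw [((hgain _ hYW.1) C hC).2, hE.blockCount_eq hC, if_congr (hMN C hC) rfl rfl]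
    split_ifs <;> rfl
  obtain ⟨D₀, hD₀, hND₀⟩ := exists_superset_of_le hWZ.1 hNW
  have hMD₀ : A ∪ B ⊆ D₀ := subset_union_left.trans hND₀
  have hcountD : ∀ D ∈ Z.part.parts, X.part.blockCount D =
      W.part.blockCount D + if N ⊆ D then 2 else 0 := fun D hD => by
    rw [blockCount_eq_add_of_eq_add hXW hWZ.1 hD hcount, blockSum_single hNW]
  -- The gain `g` on `N` over `X` has to suit `Y`, `Y'` and `Z`; the least value allowed by the
  -- lower bounds is taken. Each lower bound is below each upper one because `w, w' ≤ 1`, `Y, Y' ≤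
  -- Z` and `D₀` contains at least three blocks of `X`.
  obtain ⟨g, hg⟩ : ∃ g, w ≤ g ∧ w' ≤ g ∧ g ≤ w + 1 ∧ g ≤ w' + 1 ∧
      X.part.blockSum X.tcWt D₀ + g ≤ Z.tcWt D₀ ∧
      Z.tcWt D₀ + 3 ≤ X.part.blockSum X.tcWt D₀ + g + X.part.blockCount D₀ := by
    have h1 := (tc_le_iff.1 hZ).2 D₀ hD₀
    have h2 := (tc_le_iff.1 hZ').2 D₀ hD₀
    have h3 := hgain _ hZ.1 D₀ hD₀
    have h4 := hgain' _ hZ'.1 D₀ hD₀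
    have h5 := hcountD D₀ hD₀
    have h6 := blockCount_pos hNW hND₀
    rw [if_pos hMD₀, if_pos hMD₀] at h3
    rw [if_pos (hs.trans hND₀), if_pos (hs.trans hND₀)] at h4
    rw [if_pos hND₀] at h5
    refine ⟨max (max w w') (Z.tcWt D₀ + 3 -
      (X.part.blockSum X.tcWt D₀ + X.part.blockCount D₀)), ?_⟩
    omega
  let f : Finset (Fin n) → ℕ := fun C => X.part.blockSum X.tcWt C + if C = N then g else 0
  have hf : ∀ C ∈ W.part.parts, f C < C.card := fun C hC => by
    have h1 := blockSum_add_blockCount_le (D := C) fun _ => tcWt_lt X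
    rw [hcount C hC] at h1
    simp only [f]
    split_ifs at h1 ⊢ <;> omega
  have hW : ∀ C ∈ W.part.parts, (W.withWeights f hf).tcWt C = f C := fun C hC =>
    tcWt_withWeights W hf hC
  have hYW₂ : Y ≤ W.withWeights f hf := tc_le_iff.2 ⟨hYW, fun C hC => by
    have h1 := hgain _ hYW.1 C hC
    have h2 := hcount C hC
    rw [if_congr (hMN C hC) rfl rfl, if_congr (hMN C hC) rfl rfl] at h1
    rw [hW C hC]
    simp only [f]
    split_ifs at h1 h2 ⊢ <;> omega⟩
  have hYW₂' : Y' ≤ W.withWeights f hf := tc_le_iff.2 ⟨hYW', fun C hC => by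
    have h1 := hgain' _ hYW'.1 C hC
    have h2 := hcount C hC
    rw [if_congr (hMN' C hC) rfl rfl, if_congr (hMN' C hC) rfl rfl] at h1
    rw [hW C hC]
    simp only [f]
    split_ifs at h1 h2 ⊢ <;> omega⟩
  refine ⟨W.withWeights f hf, tc_le_iff.2 ⟨hWZ, fun D hD => ?_⟩, ?_, ?_⟩
  · have h1 : W.part.blockSum (W.withWeights f hf).tcWt D =
        X.part.blockSum X.tcWt D + if N ⊆ D then g else 0 := by
      rw [blockSum_eq_add_of_eq_add hXW hWZ.1 hD hW, blockSum_single hNW]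
    have h2 := hcountD D hD
    show W.part.blockSum (W.withWeights f hf).tcWt D ≤ _ ∧
      _ ≤ W.part.blockSum (W.withWeights f hf).tcWt D + W.part.blockCount D
    rw [h1]
    by_cases hND : N ⊆ D
    · obtain rfl : D = D₀ := Z.part.eq_of_mem_parts hD hD₀ (hND (mem_union_left _ ha)) (hMD₀ ha)
      rw [if_pos hND] at h2 ⊢
      omega
    · have hMD : ¬ A ∪ B ⊆ D := fun hMD => hND (subset_of_le hWZ.1 hNW hD
        (mem_union_left _ ha) (hMD ha))
      have h3 := hgain _ hZ.1 D hD
      have h4 := (tc_le_iff.1 hZ).2 D hD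
      rw [if_neg hND] at h2 ⊢
      rw [if_neg hMD, if_neg hMD] at h3
      omega
  · exact (tc_covBy_iff hgen hP).2 ⟨hYW₂, hE.card⟩
  · have h1 := hE.card
    have h2 := hm.card
    have h3 := hm'.card
    exact (tc_covBy_iff hgen hP).2 ⟨hYW₂', show W.part.parts.card + 1 = _ by omega⟩

/-- The gains `w` and `w'` fall into different blocks of `Z`, so the bounds imposed by `Z` do not
interact and both merges can be performed with their own weights. -/
theorem exists_common_cover_of_separated {X Y Y' Z : P.tc.Partition n} (h : X ⋖ Y) (h' : X ⋖ Y')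
    (hZ : Y ≤ Z) (hZ' : Y' ≤ Z)
    (hsm : Y.forgetWeights ≠ Y'.forgetWeights → ∃ W ≤ Z.forgetWeights,
      Y.forgetWeights ⋖ W ∧ Y'.forgetWeights ⋖ W)
    {A B A' B' : Finset (Fin n)} (hm : IsMerge X.part Y.part A B)
    (hm' : IsMerge X.part Y'.part A' B')
    (hsep : ∀ D ∈ Z.part.parts, A ∪ B ⊆ D → ¬ A' ∪ B' ⊆ D) :
    ∃ W ≤ Z, Y ⋖ W ∧ Y' ⋖ W := by
  obtain ⟨D₁, hD₁, hMD₁⟩ := exists_superset_of_le hZ.1 hm.union_mem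
  have hMM : A ∪ B ≠ A' ∪ B' := fun he => hsep D₁ hD₁ hMD₁ (he ▸ hMD₁)
  obtain ⟨W, hWZ, hYW, hYW'⟩ := hsm fun heq => by
    have hp : Y.part = Y'.part := congrArg (fun α : P.Partition n => α.part) heq
    exact hm.union_notMem (hm'.mem_of_ne (hp ▸ hm.union_mem) hMM)
  obtain ⟨C, D, hW⟩ := exists_isMerge_of_covBy hgen hP hYW
  have hsepW : ∀ F ∈ W.part.parts, A ∪ B ⊆ F → ¬ A' ∪ B' ⊆ F := by
    intro F hF h1 h2
    obtain ⟨G, hG, hFG⟩ := exists_superset_of_le hWZ.1 hF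
    exact hsep G hG (h1.trans hFG) (h2.trans hFG)
  -- The block of `W` around `A' ∪ B'` is the new one and avoids `A ∪ B`, so it is made of two
  -- blocks of `X`, namely `A'` and `B'`.
  have hWM : IsMerge Y.part W.part A' B' ∧ A ∪ B ∈ W.part.parts := by
    obtain ⟨F, hF, hMF⟩ := exists_superset_of_le hYW'.le.1 hm'.union_mem
    have hF' : F = C ∪ D := by
      by_contra hne
      have hFY := hW.mem_of_ne hF hne
      by_cases hFM : F = A ∪ B
      · exact hsepW F hF hFM.ge hMF
      · exact hm'.eq_of_subset_of_mem (hm.mem_of_ne hFY hFM) hMF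
    subst hF'
    have hC : C ≠ A ∪ B := fun he => hsepW _ hF (he ▸ subset_union_left) hMF
    have hD : D ≠ A ∪ B := fun he => hsepW _ hF (he ▸ subset_union_right) hMF
    have hCX := hm.mem_of_ne hW.left_mem hC
    have hDX := hm.mem_of_ne hW.right_mem hD
    obtain ⟨ρ, hρ⟩ := exists_isMerge hCX hDX hW.ne
    refine ⟨?_, hW.mem_iff.2 (.inr ⟨hm.union_mem, hC.symm, hD.symm⟩)⟩
    rcases hρ.eq_or_eq_of_subset hm'.left_mem (subset_union_left.trans hMF) with rfl | rfl <;>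
      rcases hρ.eq_or_eq_of_subset hm'.right_mem (subset_union_right.trans hMF) with rfl | rfl
    · exact absurd rfl hm'.ne
    · exact hW
    · exact hW.symm
    · exact absurd rfl hm'.ne
  obtain ⟨hW, hMW⟩ := hWM
  have hMW' := hW.union_mem
  obtain ⟨w, hw, hgain⟩ := exists_gain h.le hm
  obtain ⟨w', hw', hgain'⟩ := exists_gain h'.le hm'
  have hXW : X.part ≤ W.part := h.le.1.trans hYW.le.1
  obtain ⟨a, haA⟩ := X.part.nonempty_of_mem_parts hm.left_mem
  obtain ⟨a', haA'⟩ := X.part.nonempty_of_mem_parts hm'.left_mem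
  have ha := mem_union_left B haA
  have ha' := mem_union_left B' haA'
  have hMN : ∀ F ∈ W.part.parts, A ∪ B ⊆ F ↔ F = A ∪ B := fun F hF =>
    ⟨fun hMF => W.part.eq_of_mem_parts hF hMW (hMF ha) ha, fun hF => hF ▸ subset_rfl⟩
  have hMN' : ∀ F ∈ W.part.parts, A' ∪ B' ⊆ F ↔ F = A' ∪ B' := fun F hF =>
    ⟨fun hMF => W.part.eq_of_mem_parts hF hMW' (hMF ha') ha', fun hF => hF ▸ subset_rfl⟩
  have hcount : ∀ F ∈ W.part.parts, X.part.blockCount F =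
      1 + ((if F = A ∪ B then 1 else 0) + if F = A' ∪ B' then 1 else 0) := by
    intro F hF
    rw [((hgain _ hYW.le.1) F hF).2, hW.blockCount_eq hF, if_congr (hMN F hF) rfl rfl]
    omega
  let f : Finset (Fin n) → ℕ := fun F => X.part.blockSum X.tcWt F +
    ((if F = A ∪ B then w else 0) + if F = A' ∪ B' then w' else 0)
  have hf : ∀ F ∈ W.part.parts, f F < F.card := fun F hF => by
    have h1 := blockSum_add_blockCount_le (D := F) fun _ => tcWt_lt X
    rw [hcount F hF] at h1
    simp only [f]
    split_ifs at h1 ⊢ <;> omega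
  have hWf : ∀ F ∈ W.part.parts, (W.withWeights f hf).tcWt F = f F := fun F hF =>
    tcWt_withWeights W hf hF
  have hYW₂ : Y ≤ W.withWeights f hf := tc_le_iff.2 ⟨hYW.le, fun F hF => by
    have h1 := hgain _ hYW.le.1 F hF
    have h2 := hcount F hF
    rw [if_congr (hMN F hF) rfl rfl, if_congr (hMN F hF) rfl rfl] at h1
    rw [hWf F hF]
    simp only [f]
    split_ifs at h1 h2 ⊢ <;> omega⟩
  have hYW₂' : Y' ≤ W.withWeights f hf := tc_le_iff.2 ⟨hYW'.le, fun F hF => by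
    have h1 := hgain' _ hYW'.le.1 F hF
    have h2 := hcount F hF
    rw [if_congr (hMN' F hF) rfl rfl, if_congr (hMN' F hF) rfl rfl] at h1
    rw [hWf F hF]
    simp only [f]
    split_ifs at h1 h2 ⊢ <;> omega⟩
  refine ⟨W.withWeights f hf, tc_le_iff.2 ⟨hWZ, fun F hF => ?_⟩, ?_, ?_⟩
  · have h1 : W.part.blockSum (W.withWeights f hf).tcWt F = X.part.blockSum X.tcWt F +
        ((if A ∪ B ⊆ F then w else 0) + if A' ∪ B' ⊆ F then w' else 0) := by
      rw [blockSum_eq_add_of_eq_add hXW hWZ.1 hF hWf, blockSum_add, blockSum_single hMW,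
        blockSum_single hMW']
    have h2 : X.part.blockCount F = W.part.blockCount F +
        ((if A ∪ B ⊆ F then 1 else 0) + if A' ∪ B' ⊆ F then 1 else 0) := by
      rw [blockCount_eq_add_of_eq_add hXW hWZ.1 hF hcount, blockSum_add, blockSum_single hMW,
        blockSum_single hMW']
    have h3 := hgain _ hZ.1 F hF
    have h4 := (tc_le_iff.1 hZ).2 F hF
    have h5 := hgain' _ hZ'.1 F hF
    have h6 := (tc_le_iff.1 hZ').2 F hF
    have h7 := hsep F hF
    show W.part.blockSum (W.withWeights f hf).tcWt F ≤ _ ∧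
      _ ≤ W.part.blockSum (W.withWeights f hf).tcWt F + W.part.blockCount F
    rw [h1]
    split_ifs at h2 h3 h5 ⊢
    · tauto
    all_goals omega
  · exact (tc_covBy_iff hgen hP).2 ⟨hYW₂, hW.card⟩
  · have h1 := hW.card
    have h2 := hm.card
    have h3 := hm'.card
    exact (tc_covBy_iff hgen hP).2 ⟨hYW₂', show W.part.parts.card + 1 = _ by omega⟩

theorem exists_common_cover_or {X Y Y' Z : P.tc.Partition n} (h : X ⋖ Y) (h' : X ⋖ Y')
    (hne : Y ≠ Y') (hZ : Y ≤ Z) (hZ' : Y' ≤ Z)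
    (hsm : ∀ α β β' : P.Partition n, α ⋖ β → α ⋖ β' → β ≠ β' → β ≤ Z.forgetWeights →
      β' ≤ Z.forgetWeights → ∃ W ≤ Z.forgetWeights, β ⋖ W ∧ β' ⋖ W)
    (hk : mergeKey X.part Y.part ≤ mergeKey X.part Y'.part) :
    (∃ W ≤ Z, Y ⋖ W ∧ Y' ⋖ W) ∨ ∃ Y'', X ⋖ Y'' ∧
      mergeKey X.part Y''.part < mergeKey X.part Y'.part ∧ ∃ W ≤ Z, Y'' ⋖ W ∧ Y' ⋖ W := by
  have hgen' : ∀ {k : ℕ} (p : P.tc.Op k), P.tc.IsTreeValue p := fun p => tc_isTreeValue hgen p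
  have hP' := tc_isWeaklyAssociative hP
  have hsm' : ∀ Y : P.tc.Partition n, X ⋖ Y → Y ≤ Z → Y.forgetWeights ≠ Y'.forgetWeights →
      ∃ W ≤ Z.forgetWeights, Y.forgetWeights ⋖ W ∧ Y'.forgetWeights ⋖ W := fun Y h hZ hne =>
    hsm _ _ _ (forgetWeights_covBy hgen hP h) (forgetWeights_covBy hgen hP h') hne
      (tc_le_iff.1 hZ).1 (tc_le_iff.1 hZ').1
  obtain ⟨A, B, hm⟩ := exists_isMerge_of_covBy hgen' hP' h
  obtain ⟨A', B', hm'⟩ := exists_isMerge_of_covBy hgen' hP' h'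
  by_cases hmeet : ∃ a, a ∈ A ∪ B ∧ a ∈ A' ∪ B'
  · obtain ⟨a, ha, ha'⟩ := hmeet
    exact .inl (exists_common_cover_of_mem hgen hP h h' hne hZ hZ' (hsm' Y h hZ) hm hm' ha ha')
  by_cases hsep : ∀ D ∈ Z.part.parts, A ∪ B ⊆ D → ¬ A' ∪ B' ⊆ D
  · exact .inl (exists_common_cover_of_separated hgen hP h h' hZ hZ' (hsm' Y h hZ) hm hm' hsep)
  · push Not at hsep
    obtain ⟨D, hD, hMD, hMD'⟩ := hsep
    obtain ⟨a, ha, hak⟩ := hm.exists_mergeKey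
    obtain ⟨a', ha', hak'⟩ := hm'.exists_mergeKey
    have hlt : mergeKey X.part Y.part < mergeKey X.part Y'.part := by
      refine lt_of_le_of_ne hk fun he => hmeet ⟨a, ha, ?_⟩
      rwa [Fin.ext (hak.trans (he.trans hak'.symm))]
    -- The remaining case: disjoint merged blocks in one block of `Z`. Merging the block of `a` with
    -- `A'` lowers the key to at most `a` and meets `A' ∪ B'`.
    obtain ⟨A₀, hA₀, haA₀⟩ := X.part.exists_mem (mem_univ a)
    have hne₀ : A₀ ≠ A' := by
      rintro rfl
      exact hmeet ⟨a, ha, mem_union_left _ haA₀⟩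
    obtain ⟨Y'', h1, h2, hm''⟩ := exists_merge hgen' hP' (h.le.trans hZ) hA₀ hm'.left_mem hne₀ hD
      (subset_of_le (h.le.trans hZ).1 hA₀ hD haA₀ (hMD ha)) (subset_union_left.trans hMD')
    have hcov : X ⋖ Y'' := (covBy_iff hgen' hP').2 ⟨h1, hm''.card⟩
    have hk'' : mergeKey X.part Y''.part < mergeKey X.part Y'.part :=
      (hm''.mergeKey_le (mem_union_left _ haA₀)).trans_lt (hak.trans_lt hlt)
    obtain ⟨b, hb⟩ := X.part.nonempty_of_mem_parts hm'.left_mem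
    refine .inr ⟨Y'', hcov, hk'', exists_common_cover_of_mem hgen hP hcov h' ?_ h2 hZ'
      (hsm' Y'' hcov h2) hm'' hm' (mem_union_right _ hb) (mem_union_left _ hb)⟩
    rintro rfl
    exact lt_irrefl _ hk''

end CommonCover

end SetOperad.Partition

/-! ### Intervals -/

theorem Set.OrdConnected.covBy_coe_iff {α : Type*} [PartialOrder α] {s : Set α}
    (hs : s.OrdConnected) {a b : s} : (a : α) ⋖ b ↔ a ⋖ b :=
  Set.OrdConnected.apply_covBy_apply_iff (OrderEmbedding.subtype fun x => x ∈ s)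
    (by simpa using hs)

/-- Semimodularity of the subinterval `[a, d]`, rather than of the whole interval, is what keeps the
common cover below `d`. -/
theorem IsTotallySemimodular.exists_common_cover {α : Type*} [PartialOrder α] [OrderBot α] {γ : α}
    (h : IsTotallySemimodular (Set.Icc ⊥ γ)) {a b c d : α} (hab : a ⋖ b) (hac : a ⋖ c)
    (hbc : b ≠ c) (hbd : b ≤ d) (hcd : c ≤ d) (hd : d ≤ γ) : ∃ w ≤ d, b ⋖ w ∧ c ⋖ w := by
  have had := hab.le.trans hbd
  let i : (x : α) → x ≤ d → Set.Icc ⊥ γ := fun x hx => ⟨x, bot_le, hx.trans hd⟩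
  let j : (x : α) → a ≤ x → (hx : x ≤ d) → Set.Icc (i a had) (i d le_rfl) := fun x hax hx =>
    ⟨i x hx, hax, hx⟩
  have hcov : ∀ {x y : Set.Icc (i a had) (i d le_rfl)}, x ⋖ y ↔ x.1.1 ⋖ y.1.1 := by
    intro x y
    rw [← Set.ordConnected_Icc.covBy_coe_iff, ← Set.ordConnected_Icc.covBy_coe_iff]
  obtain ⟨w, hw1, hw2⟩ := (h.2.2 (i a had) (i d le_rfl) had).2.2 (j a le_rfl had)
    (j b hab.le hbd) (j c hac.le hcd)
    (fun he => hbc (congrArg (fun x => x.1.1) he)) (hcov.2 hab) (hcov.2 hac)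
  exact ⟨w.1.1, w.2.2, hcov.1 hw1, hcov.1 hw2⟩

namespace SetOperad.Partition

open Finpartition

theorem isCLShellable_Icc_bot {P : SetOperad.{u}} [P.IsReduced]
    (hgen : ∀ {k : ℕ} (p : P.Op k), P.IsTreeValue p) (hP : P.IsWeaklyAssociative) {n : ℕ}
    {γ : P.tc.Partition n} (hγ : IsTotallySemimodular (Set.Icc ⊥ γ.forgetWeights)) :
    IsCLShellable (Set.Icc ⊥ γ) := by
  have hgen' : ∀ {k : ℕ} (p : P.tc.Op k), P.tc.IsTreeValue p := fun p => tc_isTreeValue hgen p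
  have hP' := tc_isWeaklyAssociative hP
  have := finite_Icc_bot hγ.1
  have hcov : ∀ {x y : Set.Icc ⊥ γ}, x ⋖ y ↔ x.1 ⋖ y.1 := Set.ordConnected_Icc.covBy_coe_iff.symm
  refine isCLShellable_of_key
    ⟨⟨⟨⊥, le_rfl, bot_le⟩, fun x => x.2.1⟩, ⟨⟨γ, bot_le, le_rfl⟩, fun x => x.2.2⟩⟩
    -- A partition of `n` points has at most `n` blocks, so the subtraction is not truncated.
    (rk := fun x => n - x.1.part.parts.card) (fun x y hxy => ?_)
    (fun x y => mergeKey x.1.part y.1.part) ?_ ?_ ?_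
  · have h1 := ((covBy_iff hgen' hP').1 (hcov.1 hxy)).2
    have h2 : x.1.part.parts.card ≤ n := by simpa using x.1.part.card_parts_le_card
    omega
  · intro x₀ x x' y h1 h2 h3 h4 hne hk
    exact mergeKey_le_of_covBy hgen' hP' (hcov.1 h1) (hcov.1 h2) (hcov.1 h3) (hcov.1 h4)
      (fun he => hne (Subtype.ext he)) hk
  · intro x₀ x y h1 h2 hk
    obtain ⟨x', h3, h4, h5⟩ := exists_covBy_mergeKey_lt hgen' hP' (hcov.1 h1) (hcov.1 h2) hk
    exact ⟨⟨x', bot_le, h4.le.trans y.2.2⟩, hcov.2 h3, hcov.2 h4, h5⟩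
  · intro x y y' z h1 h2 hne hz hz' hk
    rcases exists_common_cover_or hgen hP (hcov.1 h1) (hcov.1 h2) (fun he => hne (Subtype.ext he))
      hz hz' (fun α β β' h3 h4 h5 h6 h7 => hγ.exists_common_cover h3 h4 h5 h6 h7
        (tc_le_iff.1 z.2.2).1) hk with ⟨w, hw, h3, h4⟩ | ⟨y'', h3, h4, w, hw, h5, h6⟩
    · exact .inl ⟨⟨w, bot_le, hw.trans z.2.2⟩, hw, hcov.2 h3, hcov.2 h4⟩
    · exact .inr ⟨⟨y'', bot_le, h5.le.trans (hw.trans z.2.2)⟩, hcov.2 h3, h4,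
        ⟨w, bot_le, hw.trans z.2.2⟩, hw, hcov.2 h5, hcov.2 h6⟩

end SetOperad.Partition

theorem mainTheorem3 (P : SetOperad.{u}) [P.IsBinaryQuadratic] (hP : P.IsWeaklyAssociative)
    (hsm : ∀ (n : ℕ) (γ : P.Partition n), IsMax γ → IsTotallySemimodular (Set.Icc ⊥ γ)) :
    ∀ n : ℕ,
      (∃ φ : P.tc.Partition n ≃o
          FiberProduct (fun α : P.Partition n => α.part)
            (fun β : SetOperad.tcCom.Partition n => β.part),
        ∀ γ : P.tc.Partition n, (φ γ).1 = (γ.forgetWeights, γ.weights)) ∧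
      ∀ γ : P.tc.Partition n, IsMax γ → IsCLShellable (Set.Icc ⊥ γ) := fun n =>
  ⟨SetOperad.Partition.exists_orderIso_fiberProduct n, fun γ hγ =>
    SetOperad.Partition.isCLShellable_Icc_bot SetOperad.IsBinaryQuadratic.generated hP
      (hsm n γ.forgetWeights (SetOperad.Partition.isMax_forgetWeights hγ))⟩
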